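/- An oriented marked graph diagram is a link diagram in $\mathbb R^2$ possibly with marked $4$-valent vertices (each vertex carries a marker, a short segment bisecting two opposite angles between the four edges), whose edges are oriented so that around each marked vertex incoming and outgoing edge ends alternate. Local moves are applied in either direction, in a disc whose image may be placed anywhere by a plane isotopy. To describe them, read diagrams in a rectangle from bottom to top. For adjacent strands number $i,i+1$ (counted from $0$) let $s_i$ be a crossing whose over-strand runs from lower left to upper right, $\bar s_i$ a crossing whose over-strand runs from lower right to upper left, $h_i$ and $v_i$ a marked vertex with horizontal, respectively vertical, marker, $\cup_i$ a local minimum that creates the strands $i,i+1$, and $\cap_i$ a local maximum that ends them. Words are read from left to right as diagrams from bottom to top; $1$ denotes vertical strands. The unoriented Yoshikawa moves (with their mirror moves) are the following moves. * $\Omega_1:\ \cup_1 s_0\cap_1\leftrightarrow 1$, $\quad\Omega_{1a}:\ \cup_1\bar s_0\cap_1\leftrightarrow 1$, $\quad\Omega_2:\ s_0\bar s_0\leftrightarrow 1$; * $\Omega_3:\ s_0s_1\bar s_0\leftrightarrow\bar s_1s_0s_1$, $\quad\Omega_{3a}:\ s_0s_1s_0\leftrightarrow s_1s_0s_1$; *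 $\Omega_4:\ s_0s_1h_0\leftrightarrow h_1s_0s_1$, $\quad\Omega_4':\ \bar s_0\bar s_1h_0\leftrightarrow h_1\bar s_0\bar s_1$, $\quad\Omega_{4a}:\ s_0s_1v_0\leftrightarrow v_1s_0s_1$, $\quad\Omega_{4a}':\ \bar s_0\bar s_1v_0\leftrightarrow v_1\bar s_0\bar s_1$; * $\Omega_5:\ \bar s_0v_0\leftrightarrow v_0\bar s_0$, $\quad\Omega_{5a}:\ \bar s_0h_0\leftrightarrow h_0\bar s_0$, $\quad\Omega_{5b}:\ s_0v_0\leftrightarrow v_0s_0$, $\quad\Omega_{5c}:\ s_0h_0\leftrightarrow h_0s_0$; * $\Omega_6:\ \cup_1v_0\cap_1\leftrightarrow 1$, $\quad\Omega_6':\ \cup_1h_0\cap_1\leftrightarrow 1$, $\quad\Omega_7:\ v_0h_1\leftrightarrow h_1v_0$; * $\Omega_8:\ s_1s_0s_2s_1v_0h_2\leftrightarrow\bar s_1\bar s_0\bar s_2\bar s_1v_0h_2$, $\quad\Omega_{8a}:\ s_1s_0s_2s_1h_0v_2\leftrightarrow\bar s_1\bar s_0\bar s_2\bar s_1h_0v_2$.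 The oriented Yoshikawa moves are these moves with all possible orientations (the same on the boundary of the disc for both sides). Writing $u$ and $d$ for upward and downward, the directions of the lower ends (which determine the orientation) of the following oriented moves are: $\Gamma_1$: $\Omega_1$ with $u$; $\Gamma_{1a}$: $\Omega_{1a}$ with $u$; $\Gamma_{2b}$, $\Gamma_{2c}$: $\Omega_2$ with $ud$ and with $du$; $\Gamma_{3a}$: $\Omega_{3a}$ with $uuu$; $\Gamma_4$, $\Gamma_4'$: $\Omega_4$, $\Omega_4'$ with $uud$; $\Gamma_5$: $\Omega_5$ with $ud$; $\Gamma_6$, $\Gamma_6'$: $\Omega_6$, $\Omega_6'$ with $u$; $\Gamma_7$: $\Omega_7$ with $udu$; $\Gamma_8$: $\Omega_8$ with $udud$. **Theorem 1.4.** The set $$\mathfrak S_2=\{\Gamma_1,\Gamma_{1a},\Gamma_{2b},\Gamma_{2c},\Gamma_{3a},\Gamma_4,\Gamma_4',\Gamma_5,\Gamma_6,\Gamma_6',\Gamma_7,\Gamma_8\}$$ is a generating set of oriented Yoshikawa moves: its elements are oriented Yoshikawa moves, and every oriented Yoshikawa move is obtained by a finite sequence of plane isotopies and moves in $\mathfrak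 S_2$. Moreover, its element $\Gamma_{3a}$ is an oriented $\Omega_{3a}$ move all three of whose crossings are positive (on either side) and which is non-cyclic, that is, its central triangle is not cyclically oriented (on either side). -/

import Mathlib

namespace MarkedGraph

/-!
Marked graph diagrams in the plane are written as sliced diagrams: after a small plane isotopy the
height function is generic, and the diagram, read from bottom to top, is a finite stack of
horizontal layers.  A layer contains one elementary piece (a local minimum, a local maximum, a
crossing or a marked vertex) with `pos` vertical strands to its left and any number of vertical
strands to its right.  A plane isotopy of sliced diagrams is a finite sequence of the elementary
plane isotopies of the set `planarIsotopies` below: exchange of heights of two pieces lying side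
by side, straightening of an S-shaped strand, and a quarter turn of a crossing or of a marked
vertex next to a local maximum.
-/

/-! ## Unoriented pieces -/

/-- Which strand of a crossing is the over-strand: `slash` is the strand that joins the south-west
end to the north-east end, `backslash` the one that joins the south-east end to the north-west
end. -/
inductive Slope
  | slash
  | backslash
  deriving DecidableEq

/-- Direction of the marker of a marked vertex. The four edges at the vertex leave in the directions
north-west, north-east, south-west, south-east. -/
inductive Marker
  | horizontal
  | vertical
  deriving DecidableEq

/-- Elementary pieces: a local minimum, a local maximum, a crossing, a marked vertex. -/
inductive Piece
  | cup
  | cap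
  | crossing (s : Slope)
  | vertex (m : Marker)
  deriving DecidableEq

/-- Number of lower ends. -/
def Piece.ins : Piece → ℕ
  | .cup => 0
  | _ => 2

/-- Number of upper ends. -/
def Piece.outs : Piece → ℕ
  | .cap => 0
  | _ => 2

/-- A layer: the piece, with exactly `pos` vertical strands to the left of it. -/
structure Layer (P : Type) where
  pos : ℕ
  piece : P
  deriving DecidableEq

/-- Put `k` further vertical strands to the left of a stack of layers. -/
def shift {P : Type} (k : ℕ) (D : List (Layer P)) : List (Layer P) :=
  D.map fun L => ⟨k + L.pos, L.piece⟩

/-- An unoriented local move: two stacks of layers (the first layer is the lowest one), each with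
`width` lower ends, that replace each other. -/
structure LocalMove where
  width : ℕ
  lhs : List (Layer Piece)
  rhs : List (Layer Piece)
  deriving DecidableEq

/-! ## Orientations -/

/-- Direction of a strand at a level between two layers. -/
inductive Dir
  | up
  | down
  deriving DecidableEq

/-- The opposite direction. -/
def Dir.flip : Dir → Dir
  | .up => .down
  | .down => .up

/-- Oriented pieces. The directions given are those of the left end of a local minimum or maximum,
of the strands of a crossing that start at its south-west and at its south-east end, and of the
south-west edge of a marked vertex. -/
inductive OPiece
  | cup (d : Dir)
  | cap (d : Dir)
  | crossing (s : Slope) (a b : Dir)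
  | vertex (m : Marker) (d : Dir)
  deriving DecidableEq

/-- Directions of the lower ends, from left to right. -/
def OPiece.bot : OPiece → List Dir
  | .cup _ => []
  | .cap d => [d, d.flip]
  | .crossing _ a b => [a, b]
  | .vertex _ d => [d, d.flip]

/-- Directions of the upper ends, from left to right. At a marked vertex incoming and outgoing edges
alternate: the edges of one diagonal point towards the vertex, those of the other one away. -/
def OPiece.top : OPiece → List Dir
  | .cup d => [d, d.flip]
  | .cap _ => []
  | .crossing _ a b => [b, a]
  | .vertex _ d => [d, d.flip]

/-- Forget the orientation. -/
def OPiece.forget : OPiece → Piece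
  | .cup _ => .cup
  | .cap _ => .cap
  | .crossing s _ _ => .crossing s
  | .vertex m _ => .vertex m

/-- Forget the orientation. -/
def forget (D : List (Layer OPiece)) : List (Layer Piece) :=
  D.map fun L => ⟨L.pos, L.piece.forget⟩

/-- Put an oriented layer on top of a level whose strands have the directions `u`: if the strands
with the numbers `pos`, `pos + 1`, ... fit the lower ends of the piece, return the directions of
the strands above the layer. -/
def Layer.run (L : Layer OPiece) (u : List Dir) : Option (List Dir) :=
  if L.pos ≤ u.length ∧ (u.drop L.pos).take L.piece.bot.length = L.piece.bot then
    some (u.take L.pos ++ L.piece.top ++ u.drop (L.pos + L.piece.bot.length))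
  else none

/-- Directions of the strands above a stack of layers, if all the layers fit. -/
def run : List (Layer OPiece) → List Dir → Option (List Dir)
  | [], u => some u
  | L :: D, u => (L.run u).bind (run D)

/-- Oriented marked graph tangle diagrams, with lower ends directed by `u` and upper ends by `v`. -/
structure Tangle (u v : List Dir) where
  layers : List (Layer OPiece)
  ok : run layers u = some v

/-- Oriented marked graph diagrams in the plane. -/
abbrev Diagram := Tangle [] []

/-- An oriented local move: two oriented tangle diagrams with the same directed ends, that replace
each other. -/
structure OrientedMove where
  bot : List Dir
  top : List Dir
  lhs : Tangle bot top
  rhs : Tangle bot top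

/-- `M` is the unoriented local move `U`, equipped with an orientation. -/
def OrientedMove.IsOrientationOf (M : OrientedMove) (U : LocalMove) : Prop :=
  M.bot.length = U.width ∧ forget M.lhs.layers = U.lhs ∧ forget M.rhs.layers = U.rhs

/-- All the moves of a set of unoriented local moves, with all possible orientations. -/
def allOrientations (𝒰 : Set LocalMove) : Set OrientedMove :=
  {M | ∃ U ∈ 𝒰, M.IsOrientationOf U}

/-- `D'` arises from `D` by one application, from its first to its second side, of a move of the set
`S`: inside a rectangle the diagram `D` is the first side of the move, `D'` is the second one, and
outside of the rectangle they agree. -/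
def Applies (S : Set OrientedMove) {u v : List Dir} (D D' : Tangle u v) : Prop :=
  ∃ M ∈ S, ∃ (below above : List (Layer OPiece)) (l r : List Dir),
    run below u = some (l ++ M.bot ++ r) ∧
    D.layers = below ++ shift l.length M.lhs.layers ++ above ∧
    D'.layers = below ++ shift l.length M.rhs.layers ++ above

/-! ## Plane isotopies -/

/-- The crossing turned by a quarter turn. -/
def Slope.turn : Slope → Slope
  | .slash => .backslash
  | .backslash => .slash

/-- The marker turned by a quarter turn. -/
def Marker.turn : Marker → Marker
  | .horizontal => .vertical
  | .vertical => .horizontal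

/-- Exchange of the heights of two pieces with `n` vertical strands between them. -/
def exchange (g : Piece) (n : ℕ) (h : Piece) : LocalMove :=
  ⟨g.ins + n + h.ins, [⟨0, g⟩, ⟨g.outs + n, h⟩], [⟨g.ins + n, h⟩, ⟨0, g⟩]⟩

/-- Straightening of a strand. -/
def zigzag : LocalMove := ⟨1, [⟨1, .cup⟩, ⟨0, .cap⟩], []⟩

/-- Straightening of a strand. -/
def zagzig : LocalMove := ⟨1, [⟨0, .cup⟩, ⟨1, .cap⟩], []⟩

/-- Quarter turn of a crossing whose north-east end runs into a local maximum. -/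
def turnCrossing (s : Slope) : LocalMove :=
  ⟨3, [⟨0, .crossing s⟩, ⟨1, .cap⟩], [⟨1, .crossing s.turn⟩, ⟨0, .cap⟩]⟩

/-- Quarter turn of a marked vertex whose north-east edge runs into a local maximum. -/
def turnVertex (m : Marker) : LocalMove :=
  ⟨3, [⟨0, .vertex m⟩, ⟨1, .cap⟩], [⟨1, .vertex m.turn⟩, ⟨0, .cap⟩]⟩

/-- The elementary plane isotopies, of oriented diagrams. -/
def planarIsotopies : Set OrientedMove :=
  allOrientations
    ({zigzag, zagzig} ∪ {U | ∃ g n h, U = exchange g n h} ∪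
      {U | ∃ s, U = turnCrossing s} ∪ {U | ∃ m, U = turnVertex m})

/-- `D` and `D'` are related by a finite sequence of plane isotopies and of moves of `S`, applied in
either direction. -/
def Related (S : Set OrientedMove) {u v : List Dir} (D D' : Tangle u v) : Prop :=
  Relation.EqvGen (fun E E' => Applies planarIsotopies E E' ∨ Applies S E E') D D'

/-! ## The unoriented Yoshikawa moves

In the moves of types 3 and 4 the strand that moves across the crossing or the vertex joins the
leftmost lower end to the rightmost upper end. -/

/-- Removal of a kink. -/
def Ω1 : LocalMove := ⟨1, [⟨1, .cup⟩, ⟨0, .crossing .slash⟩, ⟨1, .cap⟩], []⟩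

/-- Removal of a kink of the other kind. -/
def Ω1a : LocalMove := ⟨1, [⟨1, .cup⟩, ⟨0, .crossing .backslash⟩, ⟨1, .cap⟩], []⟩

/-- Removal of a bigon, the left strand lying over the right one. -/
def Ω2 : LocalMove := ⟨2, [⟨0, .crossing .slash⟩, ⟨0, .crossing .backslash⟩], []⟩

def Ω3 : LocalMove :=
  ⟨3, [⟨0, .crossing .slash⟩, ⟨1, .crossing .slash⟩, ⟨0, .crossing .backslash⟩],
      [⟨1, .crossing .backslash⟩, ⟨0, .crossing .slash⟩, ⟨1, .crossing .slash⟩]⟩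

def Ω3a : LocalMove :=
  ⟨3, [⟨0, .crossing .slash⟩, ⟨1, .crossing .slash⟩, ⟨0, .crossing .slash⟩],
      [⟨1, .crossing .slash⟩, ⟨0, .crossing .slash⟩, ⟨1, .crossing .slash⟩]⟩

/-- A strand passes over a marked vertex. -/
def Ω4 : LocalMove :=
  ⟨3, [⟨0, .crossing .slash⟩, ⟨1, .crossing .slash⟩, ⟨0, .vertex .horizontal⟩],
      [⟨1, .vertex .horizontal⟩, ⟨0, .crossing .slash⟩, ⟨1, .crossing .slash⟩]⟩

/-- A strand passes under a marked vertex. -/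
def Ω4prime : LocalMove :=
  ⟨3, [⟨0, .crossing .backslash⟩, ⟨1, .crossing .backslash⟩, ⟨0, .vertex .horizontal⟩],
      [⟨1, .vertex .horizontal⟩, ⟨0, .crossing .backslash⟩, ⟨1, .crossing .backslash⟩]⟩

def Ω4a : LocalMove :=
  ⟨3, [⟨0, .crossing .slash⟩, ⟨1, .crossing .slash⟩, ⟨0, .vertex .vertical⟩],
      [⟨1, .vertex .vertical⟩, ⟨0, .crossing .slash⟩, ⟨1, .crossing .slash⟩]⟩

def Ω4primea : LocalMove :=
  ⟨3, [⟨0, .crossing .backslash⟩, ⟨1, .crossing .backslash⟩, ⟨0, .vertex .vertical⟩],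
      [⟨1, .vertex .vertical⟩, ⟨0, .crossing .backslash⟩, ⟨1, .crossing .backslash⟩]⟩

/-- A crossing passes a marked vertex, along the marker. The usual pictures of the moves of type 5
(crossing and vertex side by side) are turned counterclockwise by a quarter turn, which turns
slopes and markers as well. -/
def Ω5 : LocalMove :=
  ⟨2, [⟨0, .crossing .backslash⟩, ⟨0, .vertex .vertical⟩],
      [⟨0, .vertex .vertical⟩, ⟨0, .crossing .backslash⟩]⟩

def Ω5a : LocalMove :=
  ⟨2, [⟨0, .crossing .backslash⟩, ⟨0, .vertex .horizontal⟩],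
      [⟨0, .vertex .horizontal⟩, ⟨0, .crossing .backslash⟩]⟩

def Ω5b : LocalMove :=
  ⟨2, [⟨0, .crossing .slash⟩, ⟨0, .vertex .vertical⟩],
      [⟨0, .vertex .vertical⟩, ⟨0, .crossing .slash⟩]⟩

def Ω5c : LocalMove :=
  ⟨2, [⟨0, .crossing .slash⟩, ⟨0, .vertex .horizontal⟩],
      [⟨0, .vertex .horizontal⟩, ⟨0, .crossing .slash⟩]⟩

/-- Removal of a marked vertex with a loop. -/
def Ω6 : LocalMove := ⟨1, [⟨1, .cup⟩, ⟨0, .vertex .vertical⟩, ⟨1, .cap⟩], []⟩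

/-- Removal of a marked vertex with a loop. -/
def Ω6prime : LocalMove := ⟨1, [⟨1, .cup⟩, ⟨0, .vertex .horizontal⟩, ⟨1, .cap⟩], []⟩

/-- Exchange of two marked vertices joined by an edge. -/
def Ω7 : LocalMove :=
  ⟨3, [⟨0, .vertex .vertical⟩, ⟨1, .vertex .horizontal⟩],
      [⟨1, .vertex .horizontal⟩, ⟨0, .vertex .vertical⟩]⟩

/-- Two pairs of strands that end in marked vertices cross each other, in all four crossings in the
same way; the move changes the four crossings. -/
def Ω8 : LocalMove :=
  ⟨4, [⟨1, .crossing .slash⟩, ⟨0, .crossing .slash⟩, ⟨2, .crossing .slash⟩,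
        ⟨1, .crossing .slash⟩, ⟨0, .vertex .vertical⟩, ⟨2, .vertex .horizontal⟩],
      [⟨1, .crossing .backslash⟩, ⟨0, .crossing .backslash⟩, ⟨2, .crossing .backslash⟩,
        ⟨1, .crossing .backslash⟩, ⟨0, .vertex .vertical⟩, ⟨2, .vertex .horizontal⟩]⟩

/-- The same with the two markers interchanged. -/
def Ω8a : LocalMove :=
  ⟨4, [⟨1, .crossing .slash⟩, ⟨0, .crossing .slash⟩, ⟨2, .crossing .slash⟩,
        ⟨1, .crossing .slash⟩, ⟨0, .vertex .horizontal⟩, ⟨2, .vertex .vertical⟩],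
      [⟨1, .crossing .backslash⟩, ⟨0, .crossing .backslash⟩, ⟨2, .crossing .backslash⟩,
        ⟨1, .crossing .backslash⟩, ⟨0, .vertex .horizontal⟩, ⟨2, .vertex .vertical⟩]⟩

/-- The unoriented Yoshikawa moves, with their mirror moves. -/
def unorientedYoshikawaMoves : Set LocalMove :=
  {Ω1, Ω1a, Ω2, Ω3, Ω3a, Ω4, Ω4prime, Ω4a, Ω4primea, Ω5, Ω5a, Ω5b, Ω5c, Ω6, Ω6prime, Ω7, Ω8, Ω8a}

/-- The oriented Yoshikawa moves: the unoriented ones with all possible orientations. -/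
def orientedYoshikawaMoves : Set OrientedMove :=
  allOrientations unorientedYoshikawaMoves

/-- A set of oriented Yoshikawa moves is generating if every oriented Yoshikawa move, applied anywhere
in any diagram, is a finite sequence of plane isotopies and of moves of the set. The diagrams may
have ends; marked graph diagrams in the plane are the case `u = v = []`, and the two sides of a
move themselves are another case. -/
def IsGeneratingSet (S : Set OrientedMove) : Prop :=
  S ⊆ orientedYoshikawaMoves ∧
  ∀ (u v : List Dir) (D D' : Tangle u v), Applies orientedYoshikawaMoves D D' → Related S D D'

/-! ## The oriented moves of the generating set -/

open Dir Slope Marker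

/-- Positive kink with a clockwise loop. -/
def Γ1 : OrientedMove where
  bot := [up]
  top := [up]
  lhs := ⟨[⟨1, .cup up⟩, ⟨0, .crossing slash up up⟩, ⟨1, .cap up⟩], rfl⟩
  rhs := ⟨[], rfl⟩

/-- Negative kink with a clockwise loop. -/
def Γ1a : OrientedMove where
  bot := [up]
  top := [up]
  lhs := ⟨[⟨1, .cup up⟩, ⟨0, .crossing backslash up up⟩, ⟨1, .cap up⟩], rfl⟩
  rhs := ⟨[], rfl⟩

/-- Bigon with antiparallel strands, the left one directed upwards. -/
def Γ2b : OrientedMove where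
  bot := [up, down]
  top := [up, down]
  lhs := ⟨[⟨0, .crossing slash up down⟩, ⟨0, .crossing backslash down up⟩], rfl⟩
  rhs := ⟨[], rfl⟩

/-- Bigon with antiparallel strands, the left one directed downwards. -/
def Γ2c : OrientedMove where
  bot := [down, up]
  top := [down, up]
  lhs := ⟨[⟨0, .crossing slash down up⟩, ⟨0, .crossing backslash up down⟩], rfl⟩
  rhs := ⟨[], rfl⟩

def Γ3a : OrientedMove where
  bot := [up, up, up]
  top := [up, up, up]
  lhs := ⟨[⟨0, .crossing slash up up⟩, ⟨1, .crossing slash up up⟩, ⟨0, .crossing slash up up⟩], rfl⟩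
  rhs := ⟨[⟨1, .crossing slash up up⟩, ⟨0, .crossing slash up up⟩, ⟨1, .crossing slash up up⟩], rfl⟩

def Γ4 : OrientedMove where
  bot := [up, up, down]
  top := [up, down, up]
  lhs := ⟨[⟨0, .crossing slash up up⟩, ⟨1, .crossing slash up down⟩, ⟨0, .vertex horizontal up⟩], rfl⟩
  rhs := ⟨[⟨1, .vertex horizontal up⟩, ⟨0, .crossing slash up up⟩, ⟨1, .crossing slash up down⟩], rfl⟩

def Γ4prime : OrientedMove where
  bot := [up, up, down]
  top := [up, down, up]
  lhs := ⟨[⟨0, .crossing backslash up up⟩, ⟨1, .crossing backslash up down⟩,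
    ⟨0, .vertex horizontal up⟩], rfl⟩
  rhs := ⟨[⟨1, .vertex horizontal up⟩, ⟨0, .crossing backslash up up⟩,
    ⟨1, .crossing backslash up down⟩], rfl⟩

def Γ5 : OrientedMove where
  bot := [up, down]
  top := [down, up]
  lhs := ⟨[⟨0, .crossing backslash up down⟩, ⟨0, .vertex vertical down⟩], rfl⟩
  rhs := ⟨[⟨0, .vertex vertical up⟩, ⟨0, .crossing backslash up down⟩], rfl⟩

def Γ6 : OrientedMove where
  bot := [up]
  top := [up]
  lhs := ⟨[⟨1, .cup down⟩, ⟨0, .vertex vertical up⟩, ⟨1, .cap down⟩], rfl⟩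
  rhs := ⟨[], rfl⟩

def Γ6prime : OrientedMove where
  bot := [up]
  top := [up]
  lhs := ⟨[⟨1, .cup down⟩, ⟨0, .vertex horizontal up⟩, ⟨1, .cap down⟩], rfl⟩
  rhs := ⟨[], rfl⟩

def Γ7 : OrientedMove where
  bot := [up, down, up]
  top := [up, down, up]
  lhs := ⟨[⟨0, .vertex vertical up⟩, ⟨1, .vertex horizontal down⟩], rfl⟩
  rhs := ⟨[⟨1, .vertex horizontal down⟩, ⟨0, .vertex vertical up⟩], rfl⟩

def Γ8 : OrientedMove where
  bot := [up, down, up, down]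
  top := [up, down, up, down]
  lhs := ⟨[⟨1, .crossing slash down up⟩, ⟨0, .crossing slash up up⟩,
    ⟨2, .crossing slash down down⟩, ⟨1, .crossing slash up down⟩,
    ⟨0, .vertex vertical up⟩, ⟨2, .vertex horizontal up⟩], rfl⟩
  rhs := ⟨[⟨1, .crossing backslash down up⟩, ⟨0, .crossing backslash up up⟩,
    ⟨2, .crossing backslash down down⟩, ⟨1, .crossing backslash up down⟩,
    ⟨0, .vertex vertical up⟩, ⟨2, .vertex horizontal up⟩], rfl⟩

/-! ## Crossing signs, and the central triangle of a move of type 3 -/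

/-- The sign of an oriented crossing: positive if the over-strand has to be turned counterclockwise
(by less than a half turn) to obtain the direction of the under-strand. -/
def crossingSign (s : Slope) (a b : Dir) : ℤ :=
  (if s = slash then 1 else -1) * (if a = b then 1 else -1)

/-- The signs of the crossings of a diagram, from the lowest to the highest crossing. -/
def crossingSigns (D : List (Layer OPiece)) : List ℤ :=
  D.filterMap fun L => match L.piece with
    | .crossing s a b => some (crossingSign s a b)
    | _ => none

/-- The diagram is one side of a move of type 3, and its central triangle is not cyclically oriented.
One edge of the triangle, directed by `b`, joins the lowest to the highest crossing; the other
two edges, directed by `a` and `c`, meet in the third crossing. The triangle is cyclically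
oriented if `a = c` and `b` is the opposite direction. -/
def HasNoncyclicTriangle : List (Layer OPiece) → Prop
  | [⟨0, .crossing _ a b⟩, ⟨1, .crossing _ _ c⟩, ⟨0, .crossing _ _ _⟩] => ¬ (a = c ∧ b ≠ a)
  | [⟨1, .crossing _ b c⟩, ⟨0, .crossing _ a _⟩, ⟨1, .crossing _ _ _⟩] => ¬ (a = c ∧ b ≠ a)
  | _ => False

end MarkedGraph

namespace MarkedGraph

open Dir Slope Marker

/-! Moves act locally, so it suffices to relate the two sides of every oriented Yoshikawa move; each
relation obtained can then be used as a move itself. Every derivation is an explicit sequence of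
rewritings of words, checked by computation for all directions, slopes and markers involved.

Two devices recur. Bending the ends of a picture turns it: a half turn keeps slopes and markers and
reverses directions, while a quarter turn of a piece exchanges both slopes and both markers.
Inserting a cancelling pair of crossings and carrying one of them through the picture changes the
order of strands, and thereby their directions.

The main obstacle is the bigon between parallel strands, which is not in the set. Sliding a kink
across another strand by `Γ3a` costs only an antiparallel bigon but leaves a parallel one on the
loop (`kink_slide`). Kinks and antiparallel bigons undo the rest, so the parallel bigon can be
removed (`bigon_parallel`). With all bigons available, turning and reordering strands give every
move of type 3.

For vertices, a crossing slid through by `Γ5` reverses the edges at the vertex, which yields all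
moves of type 4 (`Pass.flip`, `pass`). A kink then exposes the other marker and gives the rest of
type 5 (`swap_slash_horizontal`). A bigon switches the side of a loop (`loop`), a half twist on
three strands reflects the move of type 7 (`Exchange.reflect`), and conjugation by crossing ribbons
interchanges the markers in type 8 (`ribbon_move_interchanged`). -/

/-! ## Stacks of layers in context -/

/-- A stack of oriented layers. -/
abbrev Stack := List (Layer OPiece)

theorem run_append (D E : Stack) (u : List Dir) : run (D ++ E) u = (run D u).bind (run E) := by
  induction D generalizing u with
  | nil => rfl
  | cons L D ih =>
    simp only [List.cons_append, run]
    cases L.run u with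
    | none => rfl
    | some w => exact ih w

theorem run_append_of_eq {D : Stack} {u w : List Dir} (h : run D u = some w) (E : Stack) :
    run (D ++ E) u = run E w := by
  rw [run_append, h]; rfl

theorem Layer.run_piece (l r : List Dir) (g : OPiece) :
    Layer.run ⟨l.length, g⟩ (l ++ g.bot ++ r) = some (l ++ g.top ++ r) := by
  simp [Layer.run]

theorem Layer.exists_of_run {L : Layer OPiece} {u v : List Dir} (h : L.run u = some v) :
    ∃ l r, l.length = L.pos ∧ u = l ++ L.piece.bot ++ r ∧ v = l ++ L.piece.top ++ r := by
  unfold Layer.run at h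
  split_ifs at h with hc
  refine ⟨u.take L.pos, u.drop (L.pos + L.piece.bot.length), by simp [hc.1], ?_, ?_⟩
  · conv_lhs => rw [← List.take_append_drop L.pos u,
      ← List.take_append_drop L.piece.bot.length (u.drop L.pos), hc.2]
    simp
  · exact (Option.some.inj h).symm

theorem run_shift {D : Stack} {m v : List Dir} (h : run D m = some v) (l r : List Dir) :
    run (shift l.length D) (l ++ m ++ r) = some (l ++ v ++ r) := by
  induction D generalizing m with
  | nil => cases h; rfl
  | cons L D ih =>
    obtain ⟨w, hw, hD⟩ := Option.bind_eq_some_iff.mp h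
    obtain ⟨l', r', hl, rfl, rfl⟩ := Layer.exists_of_run hw
    have key := Layer.run_piece (l ++ l') (r' ++ r) L.piece
    have e : (⟨l.length + L.pos, L.piece⟩ : Layer OPiece) = ⟨(l ++ l').length, L.piece⟩ := by
      simp [hl]
    change ((Layer.run ⟨l.length + L.pos, L.piece⟩ _).bind (run (shift l.length D))) = _
    rw [e, show l ++ (l' ++ L.piece.bot ++ r') ++ r = l ++ l' ++ L.piece.bot ++ (r' ++ r) by simp,
      key]
    simpa using ih hD

theorem shift_append {P : Type} (k : ℕ) (D E : List (Layer P)) :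
    shift k (D ++ E) = shift k D ++ shift k E := by
  simp [shift]

theorem shift_shift {P : Type} (k l : ℕ) (D : List (Layer P)) :
    shift k (shift l D) = shift (k + l) D := by
  simp [shift, Nat.add_assoc]

/-- A tangle diagram placed between two stacks of layers, beside further vertical strands. -/
def Tangle.inContext {m v u w : List Dir} (below above : Stack) (l r : List Dir)
    (hb : run below u = some (l ++ m ++ r)) (ha : run above (l ++ v ++ r) = some w)
    (T : Tangle m v) : Tangle u w :=
  ⟨below ++ shift l.length T.layers ++ above, by
    rw [List.append_assoc, run_append_of_eq hb, run_append_of_eq (run_shift T.ok l r), ha]⟩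

theorem Applies.inContext {S : Set OrientedMove} {m v u w : List Dir} {below above : Stack}
    {l r : List Dir} (hb : run below u = some (l ++ m ++ r))
    (ha : run above (l ++ v ++ r) = some w) {T T' : Tangle m v} (h : Applies S T T') :
    Applies S (T.inContext below above l r hb ha) (T'.inContext below above l r hb ha) := by
  obtain ⟨M, hM, below', above', l', r', hb', hT, hT'⟩ := h
  refine ⟨M, hM, below ++ shift l.length below', shift l.length above' ++ above, l ++ l', r' ++ r,
    ?_, ?_, ?_⟩
  · rw [run_append_of_eq hb, run_shift hb']; simp
  · simp [Tangle.inContext, hT, shift_append, shift_shift]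
  · simp [Tangle.inContext, hT', shift_append, shift_shift]

theorem Related.inContext {S : Set OrientedMove} {m v u w : List Dir} {below above : Stack}
    {l r : List Dir} (hb : run below u = some (l ++ m ++ r))
    (ha : run above (l ++ v ++ r) = some w) {T T' : Tangle m v} (h : Related S T T') :
    Related S (T.inContext below above l r hb ha) (T'.inContext below above l r hb ha) := by
  induction h with
  | rel T T' h =>
    exact .rel _ _ (h.imp (fun h => h.inContext hb ha) (fun h => h.inContext hb ha))
  | refl T => exact .refl _
  | symm T T' _ ih => exact .symm _ _ ih
  | trans T T' T'' _ _ ih ih' => exact .trans _ _ _ ih ih'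

/-! ## Equivalence of stacks under the small set of moves -/

/-- The set of moves that is shown to be generating. -/
def smallMoves : Set OrientedMove :=
  {Γ1, Γ1a, Γ2b, Γ2c, Γ3a, Γ4, Γ4prime, Γ5, Γ6, Γ6prime, Γ7, Γ8}

/-- Two stacks over a level with directions `u` are tangle diagrams with the same ends and are
related by plane isotopies and moves of the small set. -/
def Equivalent (u : List Dir) (D D' : Stack) : Prop :=
  ∃ (v : List Dir) (h : run D u = some v) (h' : run D' u = some v),
    Related smallMoves (⟨D, h⟩ : Tangle u v) ⟨D', h'⟩

namespace Equivalent

variable {u : List Dir} {D D' D'' : Stack}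

theorem refl {v : List Dir} (h : run D u = some v) : Equivalent u D D :=
  ⟨v, h, h, .refl _⟩

theorem symm : Equivalent u D D' → Equivalent u D' D := fun ⟨v, h, h', hr⟩ =>
  ⟨v, h', h, .symm _ _ hr⟩

theorem trans : Equivalent u D D' → Equivalent u D' D'' → Equivalent u D D'' := by
  rintro ⟨v, h, h', hr⟩ ⟨v', k, k', kr⟩
  obtain rfl : v = v' := Option.some.inj (h'.symm.trans k)
  exact ⟨v, h, k', .trans _ _ _ hr kr⟩

theorem inContext {m l r : List Dir} (h : Equivalent m D D') {below above : Stack}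
    (hb : run below u = some (l ++ m ++ r)) {w : List Dir}
    (hw : run (below ++ shift l.length D ++ above) u = some w) :
    Equivalent u (below ++ shift l.length D ++ above) (below ++ shift l.length D' ++ above) := by
  obtain ⟨v, h, h', hr⟩ := h
  have ha : run above (l ++ v ++ r) = some w := by
    rwa [List.append_assoc, run_append_of_eq hb, run_append_of_eq (run_shift h l r)] at hw
  exact ⟨w, _, _, hr.inContext hb ha⟩

theorem of_move {M : OrientedMove} (h : M ∈ planarIsotopies ∨ M ∈ smallMoves) :
    Equivalent M.bot M.lhs.layers M.rhs.layers := by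
  have key (S : Set OrientedMove) (hM : M ∈ S) : Applies S M.lhs M.rhs :=
    ⟨M, hM, [], [], [], [], by simp [run], by simp [shift], by simp [shift]⟩
  exact ⟨M.top, M.lhs.ok, M.rhs.ok, .rel _ _ (h.imp (key _) (key _))⟩

end Equivalent

/-- Reduces generation to the bare moves: the diagram surrounding a move plays no role. -/
theorem Applies.related_of_forall_equivalent {S : Set OrientedMove}
    (hS : ∀ M ∈ S, Equivalent M.bot M.lhs.layers M.rhs.layers) {u v : List Dir}
    {D D' : Tangle u v} (h : Applies S D D') : Related smallMoves D D' := by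
  obtain ⟨M, hM, below, above, l, r, hb, hD, hD'⟩ := h
  obtain ⟨D, hDv⟩ := D
  obtain ⟨D', hDv'⟩ := D'
  subst hD hD'
  obtain ⟨w, h, h', hr⟩ := (hS M hM).inContext hb hDv
  obtain rfl : v = w := Option.some.inj (hDv.symm.trans h)
  exact hr

/-! ## Rewriting of stacks -/

/-- A partial procedure that rewrites a stack, given the directions of its lower ends, without
changing its equivalence class. -/
structure Rewrite where
  apply : List Dir → Stack → Option Stack
  sound : ∀ {u v : List Dir} {D D' : Stack}, run D u = some v → apply u D = some D' →
    Equivalent u D D'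

/-- Rewrite the part of the stack above the first `k` layers. -/
def Rewrite.above (k : ℕ) (R : Rewrite) : Rewrite where
  apply u D := (run (D.take k) u).bind fun w => (R.apply w (D.drop k)).map (D.take k ++ ·)
  sound := by
    intro u v D D' hv h
    obtain ⟨w, hw, h⟩ := Option.bind_eq_some_iff.mp h
    obtain ⟨E, hE, rfl⟩ := Option.map_eq_some_iff.mp h
    rw [← List.take_append_drop k D] at hv
    have hv' := hv
    rw [run_append_of_eq hw] at hv'
    have := (R.sound hv' hE).inContext (below := D.take k) (above := []) (l := []) (r := [])
      (by simpa using hw) (w := v) (by simpa [shift] using hv)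
    simpa [shift] using this

/-- Carry out a list of rewritings, each at the height given. -/
def rewriteAll (u : List Dir) : List (ℕ × Rewrite) → Stack → Option Stack
  | [], D => some D
  | s :: t, D => ((s.2.above s.1).apply u D).bind (rewriteAll u t)

theorem Equivalent.exists_run {u : List Dir} {D D' : Stack} (h : Equivalent u D D') :
    ∃ v, run D' u = some v :=
  h.elim fun v h => ⟨v, h.2.1⟩

theorem Equivalent.of_rewriteAll {u v : List Dir} {D D' : Stack} (t : List (ℕ × Rewrite))
    (hv : run D u = some v) (h : rewriteAll u t D = some D') : Equivalent u D D' := by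
  induction t generalizing D v with
  | nil => cases h; exact .refl hv
  | cons s t ih =>
    obtain ⟨E, hE, h⟩ := Option.bind_eq_some_iff.mp h
    have h₁ := (s.2.above s.1).sound hv hE
    obtain ⟨w, hw⟩ := h₁.exists_run
    exact h₁.trans (ih hw h)

/-- The stack is a tangle diagram, and the rewritings lead to the second stack. -/
def rewritesTo (u : List Dir) (t : List (ℕ × Rewrite)) (D D' : Stack) : Bool :=
  (run D u).isSome && decide (rewriteAll u t D = some D')

/-- Turns a picture proof into a computation. An entry `(k, R.at l)` acts above the `k` lowest
layers, with `l` strands to its left. Families contain all relevant orientations, so one list of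
entries serves every choice of directions. -/
theorem Equivalent.of_rewritesTo {u : List Dir} {D D' : Stack} (t : List (ℕ × Rewrite))
    (h : rewritesTo u t D D' = true) : Equivalent u D D' := by
  rw [rewritesTo, Bool.and_eq_true, decide_eq_true_iff] at h
  obtain ⟨v, hv⟩ := Option.isSome_iff_exists.mp h.1
  exact .of_rewriteAll t hv h.2

/-- A proved equivalence, to be used as a local move. -/
structure LocalEquivalence where
  bot : List Dir
  lhs : Stack
  rhs : Stack
  equivalent : Equivalent bot lhs rhs

/-- A finite family of local moves, usually the orientations of one unoriented move. -/
abbrev MoveFamily := List LocalEquivalence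

/-- The moves of the family, applied from the second to the first side. -/
def MoveFamily.symm (F : MoveFamily) : MoveFamily :=
  F.map fun E => ⟨E.bot, E.rhs, E.lhs, E.equivalent.symm⟩

/-- Apply a local move to the lowest layers, with `l` strands to the left of it. -/
def LocalEquivalence.at (E : LocalEquivalence) (l : ℕ) : Rewrite where
  apply u D :=
    if u = u.take l ++ E.bot ++ u.drop (l + E.bot.length) ∧ l ≤ u.length ∧
        D = shift l E.lhs ++ D.drop E.lhs.length then
      some (shift l E.rhs ++ D.drop E.lhs.length)
    else none
  sound := by
    intro u v D D' hv h
    split_ifs at h with hc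
    obtain ⟨hu, hl, hD⟩ := hc
    cases h
    have e : (u.take l).length = l := by simp [hl]
    have := E.equivalent.inContext (u := u) (below := []) (above := D.drop E.lhs.length)
      (l := u.take l) (r := u.drop (l + E.bot.length)) (by rw [← hu]; rfl) (w := v)
      (by rw [e, List.nil_append, ← hD]; exact hv)
    rw [e, List.nil_append, List.nil_append, ← hD] at this
    exact this

/-- Apply the first move of the family that fits, with `l` strands to the left of it. -/
def MoveFamily.at (F : MoveFamily) (l : ℕ) : Rewrite where
  apply u D := F.findSome? fun E => (E.at l).apply u D
  sound := by
    intro u v D D' hv h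
    obtain ⟨E, -, hE⟩ := List.exists_of_findSome?_eq_some h
    exact (E.at l).sound hv hE

/-! ## Exchange of heights -/

theorem OPiece.length_bot (g : OPiece) : g.bot.length = g.forget.ins := by
  cases g <;> rfl

theorem OPiece.length_top (g : OPiece) : g.top.length = g.forget.outs := by
  cases g <;> rfl

theorem Equivalent.exchange (g h : OPiece) (w : List Dir) :
    Equivalent (g.bot ++ w ++ h.bot) [⟨0, g⟩, ⟨g.top.length + w.length, h⟩]
      [⟨g.bot.length + w.length, h⟩, ⟨0, g⟩] := by
  have h₁ : run [⟨0, g⟩, ⟨g.top.length + w.length, h⟩] (g.bot ++ w ++ h.bot) =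
      some (g.top ++ w ++ h.top) := by
    have a := Layer.run_piece [] (w ++ h.bot) g
    have b := Layer.run_piece (g.top ++ w) [] h
    simp only [List.length_append, List.length_nil, List.nil_append, List.append_nil,
      ← List.append_assoc] at a b
    simp only [run, a, b, Option.bind_some]
  have h₂ : run [⟨g.bot.length + w.length, h⟩, ⟨0, g⟩] (g.bot ++ w ++ h.bot) =
      some (g.top ++ w ++ h.top) := by
    have a := Layer.run_piece [] (w ++ h.top) g
    have b := Layer.run_piece (g.bot ++ w) [] h
    simp only [List.length_append, List.length_nil, List.nil_append, List.append_nil,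
      ← List.append_assoc] at a b
    simp only [run, a, b, Option.bind_some]
  refine Equivalent.of_move (M := ⟨_, _, ⟨_, h₁⟩, ⟨_, h₂⟩⟩) (.inl ?_)
  refine ⟨MarkedGraph.exchange g.forget w.length h.forget,
    .inl (.inl (.inr ⟨_, _, _, rfl⟩)), ?_, ?_, ?_⟩
  · simp [MarkedGraph.exchange, OPiece.length_bot, Nat.add_assoc]
  · simp [forget, MarkedGraph.exchange, OPiece.length_top]
  · simp [forget, MarkedGraph.exchange, OPiece.length_bot]

/-- The two lowest layers exchange their heights, the second one lying to the right of the first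
one, with `n` strands in between. -/
def exchangeRight : Rewrite where
  apply u D := match D with
    | ⟨p, g⟩ :: ⟨q, h⟩ :: E =>
      -- If the second piece is not entirely to the right, truncated subtraction gives `n = 0` and
      -- the condition on `q` fails.
      let n := q - (p + g.top.length)
      let w := (u.drop (p + g.bot.length)).take n
      let r := u.drop (p + g.bot.length + n + h.bot.length)
      if u = u.take p ++ (g.bot ++ w ++ h.bot) ++ r ∧ p ≤ u.length ∧
          q = p + (g.top.length + w.length) then
        some (⟨p + (g.bot.length + w.length), h⟩ :: ⟨p, g⟩ :: E)
      else none
    | _ => none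
  sound := by
    intro u v D D' hv h
    match D with
    | [] | [_] => cases h
    | ⟨p, g⟩ :: ⟨q, h'⟩ :: E =>
      simp only at h
      split_ifs at h with hc
      obtain ⟨hu, hp, hq⟩ := hc
      cases h
      have e : (u.take p).length = p := by simp [hp]
      generalize (u.drop (p + g.bot.length)).take (q - (p + g.top.length)) = w at *
      have := (Equivalent.exchange g h' w).inContext (u := u) (below := []) (above := E)
        (l := u.take p) (by rw [← hu]; rfl) (w := v) (by
          rw [e]; simpa [shift, hq] using hv)
      simpa [e, shift, hq] using this

/-- The two lowest layers exchange their heights, the second one lying to the left of the first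
one. -/
def exchangeLeft : Rewrite where
  apply u D := match D with
    | ⟨p, g⟩ :: ⟨q, h⟩ :: E =>
      let n := p - (q + h.bot.length)
      let w := (u.drop (q + h.bot.length)).take n
      let r := u.drop (q + h.bot.length + n + g.bot.length)
      if u = u.take q ++ (h.bot ++ w ++ g.bot) ++ r ∧ q ≤ u.length ∧
          p = q + (h.bot.length + w.length) then
        some (⟨q, h⟩ :: ⟨q + (h.top.length + w.length), g⟩ :: E)
      else none
    | _ => none
  sound := by
    intro u v D D' hv h
    match D with
    | [] | [_] => cases h
    | ⟨p, g⟩ :: ⟨q, h'⟩ :: E =>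
      simp only at h
      split_ifs at h with hc
      obtain ⟨hu, hp, hq⟩ := hc
      cases h
      have e : (u.take q).length = q := by simp [hp]
      generalize (u.drop (q + h'.bot.length)).take (p - (q + h'.bot.length)) = w at *
      have := (Equivalent.exchange h' g w).symm.inContext (u := u) (below := []) (above := E)
        (l := u.take q) (by rw [← hu]; rfl) (w := v) (by
          rw [e]; simpa [shift, hq] using hv)
      simpa [e, shift, hq] using this

/-! ## Orienting unoriented words -/

/-- Letters of words that describe tangle diagrams. Only the local minima carry a direction; the
other directions are determined by those of the lower ends. -/
inductive Letter
  | cup (i : ℕ) (d : Dir)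
  | cap (i : ℕ)
  | cross (s : Slope) (i : ℕ)
  | vertex (m : Marker) (i : ℕ)

/-- The oriented layer that a letter describes over a level with directions `u`. -/
def Letter.layer (u : List Dir) : Letter → Layer OPiece
  | cup i d => ⟨i, .cup d⟩
  -- The default `up` is read only beyond the last strand, where the layer does not fit and `run`
  -- fails anyway.
  | cap i => ⟨i, .cap (u.getD i up)⟩
  | cross s i => ⟨i, .crossing s (u.getD i up) (u.getD (i + 1) up)⟩
  | vertex m i => ⟨i, .vertex m (u.getD i up)⟩

/-- The stack that a word describes over a level with directions `u`. -/
def orient : List Dir → List Letter → Stack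
  | _, [] => []
  | u, g :: W => g.layer u :: orient (((g.layer u).run u).getD []) W

/-- Equivalence of the diagrams described by two words. -/
def WordEquivalent (u : List Dir) (W W' : List Letter) : Prop :=
  Equivalent u (orient u W) (orient u W')

/-- A crossing whose over-strand joins the south-west end to the north-east end. -/
abbrev Letter.sl (i : ℕ) : Letter := cross slash i

/-- A crossing whose over-strand joins the south-east end to the north-west end. -/
abbrev Letter.bs (i : ℕ) : Letter := cross backslash i

theorem WordEquivalent.symm {u : List Dir} {W W' : List Letter} (h : WordEquivalent u W W') :
    WordEquivalent u W' W :=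
  Equivalent.symm h

theorem WordEquivalent.trans {u : List Dir} {W W' W'' : List Letter} (h : WordEquivalent u W W')
    (h' : WordEquivalent u W' W'') : WordEquivalent u W W'' :=
  Equivalent.trans h h'

/-- An equivalence of words as a local move. -/
def WordEquivalent.move {u : List Dir} {W W' : List Letter} (h : WordEquivalent u W W') :
    LocalEquivalence :=
  ⟨u, orient u W, orient u W', h⟩

theorem WordEquivalent.of_rewritesTo {u : List Dir} {W W' : List Letter}
    (t : List (ℕ × Rewrite)) (h : rewritesTo u t (orient u W) (orient u W') = true) :
    WordEquivalent u W W' :=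
  Equivalent.of_rewritesTo t h

open Letter

/-! ## Plane isotopies -/

theorem zigzag_word (a : Dir) : WordEquivalent [a] [cup 1 a.flip, cap 0] [] := by
  have h : run (orient [a] [cup 1 a.flip, cap 0]) [a] = some [a] := by cases a <;> rfl
  exact Equivalent.of_move (M := ⟨[a], [a], ⟨_, h⟩, ⟨[], rfl⟩⟩)
    (.inl ⟨zigzag, .inl (.inl (.inl (.inl rfl))), rfl, rfl, rfl⟩)

theorem zagzig_word (a : Dir) : WordEquivalent [a] [cup 0 a, cap 1] [] := by
  have h : run (orient [a] [cup 0 a, cap 1]) [a] = some [a] := by cases a <;> rfl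
  exact Equivalent.of_move (M := ⟨[a], [a], ⟨_, h⟩, ⟨[], rfl⟩⟩)
    (.inl ⟨zagzig, .inl (.inl (.inl (.inr rfl))), rfl, rfl, rfl⟩)

theorem cross_cap (s : Slope) (a b : Dir) :
    WordEquivalent [a, b, a.flip] [cross s 0, cap 1] [cross s.turn 1, cap 0] := by
  have h : run (orient [a, b, a.flip] [cross s 0, cap 1]) [a, b, a.flip] = some [b] := by
    cases a <;> cases b <;> rfl
  have h' : run (orient [a, b, a.flip] [cross s.turn 1, cap 0]) [a, b, a.flip] = some [b] := by
    cases a <;> cases b <;> rfl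
  exact Equivalent.of_move (M := ⟨_, _, ⟨_, h⟩, ⟨_, h'⟩⟩)
    (.inl ⟨turnCrossing s, .inl (.inr ⟨s, rfl⟩), rfl, rfl, rfl⟩)

theorem vertex_cap (m : Marker) (a : Dir) :
    WordEquivalent [a, a.flip, a] [vertex m 0, cap 1] [vertex m.turn 1, cap 0] := by
  have h : run (orient [a, a.flip, a] [vertex m 0, cap 1]) [a, a.flip, a] = some [a] := by
    cases a <;> rfl
  have h' : run (orient [a, a.flip, a] [vertex m.turn 1, cap 0]) [a, a.flip, a] = some [a] := by
    cases a <;> rfl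
  exact Equivalent.of_move (M := ⟨_, _, ⟨_, h⟩, ⟨_, h'⟩⟩)
    (.inl ⟨turnVertex m, .inr ⟨m, rfl⟩, rfl, rfl, rfl⟩)

/-- Both directions. -/
def dirs : List Dir := [up, down]

/-- Both slopes. -/
def slopes : List Slope := [slash, backslash]

/-- Both markers. -/
def markers : List Marker := [vertical, horizontal]

/-- Straightening of a strand with a local minimum on its right. -/
def zig : MoveFamily := dirs.map fun a => (zigzag_word a).move

/-- Straightening of a strand with a local minimum on its left. -/
def zag : MoveFamily := dirs.map fun a => (zagzig_word a).move

/-- A piece next to a local maximum makes a quarter turn. -/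
def turnCap : MoveFamily :=
  (dirs.flatMap fun a => dirs.flatMap fun b => slopes.map fun s => (cross_cap s a b).move) ++
    dirs.flatMap fun a => markers.map fun m => (vertex_cap m a).move

/-- Quarter turns are elementary only at maxima. Bending a strand brings in a maximum at which to
turn the piece; straightening then leaves the minimum on the other side. -/
theorem cup_cross (s : Slope) (a b : Dir) :
    WordEquivalent [a] [cup 1 b, cross s 0] [cup 0 b, cross s.turn 1] := by
  refine .of_rewritesTo
    [(2, zag.symm.at 0), (1, exchangeLeft), (0, exchangeLeft), (2, turnCap.symm.at 1),
      (1, exchangeLeft), (2, zig.at 2)] ?_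
  cases a <;> cases b <;> cases s <;> decide +kernel

theorem cup_vertex (m : Marker) (a : Dir) :
    WordEquivalent [a] [cup 1 a.flip, vertex m 0] [cup 0 a, vertex m.turn 1] := by
  refine .of_rewritesTo
    [(2, zag.symm.at 0), (1, exchangeLeft), (0, exchangeLeft), (2, turnCap.symm.at 1),
      (1, exchangeLeft), (2, zig.at 2)] ?_
  cases a <;> cases m <;> decide +kernel

/-- A piece next to a local minimum makes a quarter turn. -/
def turnCup : MoveFamily :=
  (dirs.flatMap fun a => dirs.flatMap fun b => slopes.map fun s => (cup_cross s a b).move) ++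
    dirs.flatMap fun a => markers.map fun m => (cup_vertex m a).move

/-! ## Antiparallel bigons and kinks -/

/-- A half turn. It preserves the directions of an antiparallel bigon and reverses those of a
parallel one. -/
theorem bigon_rotate {s : Slope} {a b : Dir}
    (h : WordEquivalent [a, b] [cross s 0, cross s.turn 0] []) :
    WordEquivalent [b.flip, a.flip] [cross s.turn 0, cross s 0] [] := by
  refine .of_rewritesTo
    [(2, zag.symm.at 0), (1, exchangeLeft), (0, exchangeLeft), (2, turnCap.symm.at 1),
      (2, zag.symm.at 2), (1, exchangeLeft), (3, exchangeLeft), (2, exchangeLeft),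
      (1, turnCup.at 1), (3, turnCap.symm.at 3), (4, exchangeLeft), (3, turnCap.symm.at 2),
      (2, h.move.at 2), (1, exchangeRight), (0, zag.at 0), (0, zag.at 1)] ?_
  cases a <;> cases b <;> cases s <;> rfl

theorem bigon_antiparallel (a : Dir) (s : Slope) :
    WordEquivalent [a, a.flip] [cross s 0, cross s.turn 0] [] := by
  have h (a : Dir) : WordEquivalent [a, a.flip] [sl 0, bs 0] [] := by
    cases a
    · exact Equivalent.of_move (M := Γ2b) (.inr (by simp [smallMoves]))
    · exact Equivalent.of_move (M := Γ2c) (.inr (by simp [smallMoves]))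
  cases s
  · exact h a
  · cases a
    · exact bigon_rotate (h up)
    · exact bigon_rotate (h down)

/-- Removal of a bigon between antiparallel strands. -/
def antiBigon : MoveFamily :=
  dirs.flatMap fun a => slopes.map fun s => (bigon_antiparallel a s).move

/-- Creation of a bigon between antiparallel strands, with a lower crossing of slope `s`. -/
def newAntiBigon (s : Slope) : MoveFamily := dirs.map fun a => (bigon_antiparallel a s).symm.move

theorem kink_up (s : Slope) : WordEquivalent [up] [cup 1 up, cross s 0, cap 1] [] := by
  cases s
  · exact Equivalent.of_move (M := Γ1) (.inr (by simp [smallMoves]))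
  · exact Equivalent.of_move (M := Γ1a) (.inr (by simp [smallMoves]))

/-- Removal of a clockwise kink. -/
def kinksUp : MoveFamily := slopes.map fun s => (kink_up s).move

theorem cup_kink_up (s : Slope) : WordEquivalent [] [cup 0 up, cross s 0] [cup 0 down] := by
  refine .of_rewritesTo
    [(2, zag.symm.at 0), (1, exchangeLeft), (2, turnCap.symm.at 1), (0, exchangeLeft),
      (1, kinksUp.at 1)] ?_
  cases s <;> decide +kernel

theorem kink (a : Dir) (s : Slope) : WordEquivalent [a] [cup 1 a, cross s 0, cap 1] [] := by
  cases a
  · exact kink_up s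
  · have h := cup_kink_up s
    refine .of_rewritesTo
      -- After a quarter turn, a second crossing is created at the minimum by an upward kink; the
      -- two crossings form an antiparallel bigon.
      [(1, turnCap.at 0), (0, h.symm.move.at 1), (1, antiBigon.at 1), (0, zig.at 0)] ?_
    cases s <;> rfl

/-- Removal of a kink. -/
def kinks : MoveFamily := dirs.flatMap fun a => slopes.map fun s => (kink a s).move

theorem cap_kink (a : Dir) (s : Slope) : WordEquivalent [a, a.flip] [cross s 0, cap 0] [cap 0] := by
  refine .of_rewritesTo
    [(0, zig.symm.at 0), (1, exchangeRight), (0, turnCup.symm.at 1), (2, exchangeRight),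
      (0, kinks.at 1)] ?_
  cases a <;> cases s <;> decide +kernel

theorem cup_kink (a : Dir) (s : Slope) :
    WordEquivalent [] [cup 0 a, cross s 0] [cup 0 a.flip] := by
  refine .of_rewritesTo
    [(2, zag.symm.at 0), (1, exchangeLeft), (2, turnCap.symm.at 1), (0, exchangeLeft),
      (1, kinks.at 1)] ?_
  cases a <;> cases s <;> decide +kernel

/-- Creation of a kink with a crossing of slope `s`. -/
def newKinks (s : Slope) : MoveFamily := dirs.map fun a => (kink a s).symm.move

/-- Removal of a kink at a local maximum. -/
def capKinks : MoveFamily := dirs.flatMap fun a => slopes.map fun s => (cap_kink a s).move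

/-- Removal of a kink at a local minimum. -/
def cupKinks : MoveFamily := dirs.flatMap fun a => slopes.map fun s => (cup_kink a s).move

/-! ## Triangles -/

/-- A move of type 3, with crossings of any slopes: `x`, `y` and `z` are the slopes of the crossings
of the strands 1 and 2, 1 and 3, and 2 and 3. -/
def Triangle (x y z : Slope) (a b c : Dir) : Prop :=
  WordEquivalent [a, b, c] [cross x 0, cross y 1, cross z 0] [cross z 1, cross y 0, cross x 1]

/-- A sixth of a turn: the first strand is bent round to become the third one, reversed, so its two
crossings change slope. Three such turns make a half turn. -/
theorem Triangle.rotate {x y z : Slope} {a b c : Dir} (h : Triangle x y z a b c) :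
    Triangle z x.turn y.turn b c a.flip := by
  unfold Triangle at *
  refine .of_rewritesTo
    [(2, zag.symm.at 1), (1, exchangeLeft), (3, exchangeLeft), (2, exchangeLeft),
      (1, turnCup.at 0), (0, exchangeLeft), (3, turnCap.symm.at 2), (1, h.symm.move.at 1),
      (3, exchangeRight), (2, turnCap.at 2), (0, turnCup.symm.at 0), (1, exchangeRight),
      (0, exchangeRight), (2, exchangeRight), (1, zag.at 1)] ?_
  cases a <;> cases b <;> cases c <;> cases x <;> cases y <;> cases z <;> rfl

theorem triangle_parallel (a : Dir) : Triangle slash slash slash a a a := by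
  have h : Triangle slash slash slash up up up :=
    Equivalent.of_move (M := Γ3a) (.inr (by simp [smallMoves]))
  cases a
  · exact h
  · exact h.rotate.rotate.rotate

/-- The move `Γ3a` and its reverse. -/
def parallelTriangles : MoveFamily := dirs.map fun a => (triangle_parallel a).move

/-! ## Parallel bigons -/

/-- A kink slides along a strand that passes over another one. -/
theorem kink_slide (a : Dir) :
    WordEquivalent [a, a] [sl 0] [cup 2 a, bs 1, sl 1, sl 0, sl 1, cap 2] := by
  -- A kink on the left strand gets an antiparallel bigon between its loop and the right strand.
  -- `Γ3a` then moves the kink past the crossing, and a quarter turn at the minimum shows the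
  -- parallel bigon `bs 1, sl 1`.
  refine .of_rewritesTo
    [(0, (newKinks slash).at 0), (1, (newAntiBigon slash).at 2), (2, exchangeLeft),
      (1, exchangeLeft), (3, turnCap.symm.at 1), (1, exchangeRight), (4, exchangeLeft),
      (2, parallelTriangles.at 0), (0, turnCup.symm.at 1)] ?_
  cases a <;> decide +kernel

/-- The moves `kink_slide`. -/
def kinkSlides : MoveFamily := dirs.map fun a => (kink_slide a).move

/-- A kink whose loop carries a parallel bigon. -/
theorem bigon_in_kink (a : Dir) :
    WordEquivalent [a, a.flip, a] [cup 3 a, bs 2, sl 2, cap 1, sl 0, cap 1] [cap 1] := by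
  -- A new antiparallel bigon supplies the crossing that completes the right side of `kink_slide`;
  -- it disappears again after that move.
  refine .of_rewritesTo
    [(0, (newAntiBigon slash).at 0), (1, exchangeRight), (2, exchangeRight), (3, exchangeRight),
      (0, exchangeRight), (4, turnCap.at 0), (0, exchangeLeft), (5, exchangeRight),
      (6, exchangeRight), (1, kinkSlides.symm.at 1), (1, turnCap.symm.at 0),
      (0, antiBigon.at 0)] ?_
  cases a <;> decide +kernel

/-- The moves `bigon_in_kink`. -/
def bigonsInKinks : MoveFamily := dirs.map fun a => (bigon_in_kink a).move

/-- A parallel bigon with all its ends bent down. The kink required by `bigon_in_kink` comes from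
one more antiparallel bigon, whose other crossing is a kink at a maximum. -/
theorem bent_bigon (a : Dir) :
    WordEquivalent [a, a.flip, a.flip, a] [cup 4 a, bs 3, sl 3, cap 2, cap 1, cap 0]
      [cap 0, cap 0] := by
  refine .of_rewritesTo
    [(0, (newAntiBigon slash).at 0), (1, exchangeRight), (2, exchangeRight), (3, exchangeRight),
      (4, exchangeRight), (0, exchangeRight), (5, turnCap.at 0), (0, exchangeLeft),
      (6, exchangeRight), (1, bigonsInKinks.at 1), (1, exchangeLeft), (0, capKinks.at 0)] ?_
  cases a <;> decide +kernel

/-- The moves `bent_bigon`. -/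
def bentBigons : MoveFamily := dirs.map fun a => (bent_bigon a).move

theorem bigon_parallel (a : Dir) (s : Slope) :
    WordEquivalent [a, a] [cross s 0, cross s.turn 0] [] := by
  have h (a : Dir) : WordEquivalent [a, a] [bs 0, sl 0] [] := by
    -- The bigon of the left side, with its strands bent so that the layers from `cup 7 a` to `cap
    -- 3` form the left side of `bent_bigon`.
    refine .trans (.symm (W := [cup 0 a, cup 1 a, cup 2 a.flip, cup 7 a, bs 6, sl 6, cap 5, cap 4,
      cap 3, cap 2]) ?_) ?_
    · refine .of_rewritesTo
        [(2, exchangeRight), (3, exchangeRight), (4, exchangeRight), (5, exchangeRight),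
          (6, exchangeRight), (7, zag.at 2), (6, exchangeRight), (5, exchangeRight),
          (4, exchangeRight), (3, exchangeRight), (2, zag.at 5), (1, exchangeRight),
          (2, exchangeRight), (3, exchangeRight), (4, zag.at 1), (0, exchangeRight),
          (1, exchangeRight), (2, zag.at 0)] ?_
      cases a <;> decide +kernel
    · refine .of_rewritesTo
        [(3, bentBigons.at 3), (3, exchangeRight), (2, exchangeRight), (1, exchangeRight),
          (3, zag.at 2), (2, zag.at 1), (0, zag.at 0)] ?_
      cases a <;> decide +kernel
  cases s
  · cases a
    · exact bigon_rotate (h down)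
    · exact bigon_rotate (h up)
  · exact h a

theorem bigon (a b : Dir) (s : Slope) :
    WordEquivalent [a, b] [cross s 0, cross s.turn 0] [] := by
  cases a <;> cases b
  exacts [bigon_parallel _ s, bigon_antiparallel _ s, bigon_antiparallel _ s, bigon_parallel _ s]

/-- Removal of a bigon. -/
def bigons : MoveFamily :=
  dirs.flatMap fun a => dirs.flatMap fun b => slopes.map fun s => (bigon a b s).move

/-- Creation of a bigon, with a lower crossing of slope `s`. -/
def newBigons (s : Slope) : MoveFamily :=
  dirs.flatMap fun a => dirs.map fun b => (bigon a b s).symm.move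

/-! ## All moves of type 3 -/

/-- Composing with the inverse of the crossing of strands 2 and 3 moves this crossing to the other
side and interchanges the roles of these strands. -/
theorem Triangle.reorder {x y z : Slope} {a b c : Dir} (h : Triangle x y z a b c) :
    Triangle y x z.turn a c b := by
  unfold Triangle at *
  refine .of_rewritesTo
    [(0, (newBigons z.turn).at 1), (1, h.symm.move.at 0), (3, bigons.at 0)] ?_
  cases a <;> cases b <;> cases c <;> cases x <;> cases y <;> cases z <;> rfl

theorem Triangle.flip_all {x y z : Slope} {a b c : Dir} (h : Triangle x y z a b c) :
    Triangle x y z a.flip b.flip c.flip := by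
  have := h.rotate.rotate.rotate
  cases x <;> cases y <;> cases z <;> exact this

/-- Each turn reverses one strand, and reorderings restore the slopes. With `flip_outer` and
`flip_all` this reaches all eight orientations. -/
theorem Triangle.flip_left {a b c : Dir} (h : Triangle slash slash slash a b c) :
    Triangle slash slash slash a.flip b.flip c := by
  have := h.rotate.reorder.rotate.reorder
  cases c <;> exact this

theorem Triangle.flip_outer {a b c : Dir} (h : Triangle slash slash slash a b c) :
    Triangle slash slash slash a.flip b c.flip := by
  have := h.reorder.rotate.reorder.rotate
  cases b <;> exact this

theorem triangle_slash (a b c : Dir) : Triangle slash slash slash a b c := by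
  have h := triangle_parallel up
  cases a <;> cases b <;> cases c
  exacts [h, h.flip_left.flip_all, h.flip_outer.flip_all, h.flip_left.flip_outer,
    h.flip_left.flip_outer.flip_all, h.flip_outer, h.flip_left, h.flip_all]

theorem triangle_left (x z : Slope) (a b c : Dir) : Triangle x x z a b c := by
  have h (z : Slope) (a b c : Dir) : Triangle slash slash z a b c := by
    cases z
    exacts [triangle_slash a b c, (triangle_slash a c b).reorder]
  cases x
  · exact h z a b c
  · cases z
    · have := (h slash b.flip c.flip a).rotate.rotate
      cases b <;> cases c <;> exact this
    · have := (h backslash c.flip a b).rotate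
      cases c <;> exact this

theorem triangle_right (x z : Slope) (a b c : Dir) : Triangle z x x a b c := by
  have := (triangle_left x.turn z c.flip a b).rotate
  cases c <;> cases x <;> exact this

/-- Moves of type 3, of a strand that passes over or under a crossing from the left or from the
right. -/
def triangles : MoveFamily :=
  slopes.flatMap fun x => slopes.flatMap fun z => dirs.flatMap fun a => dirs.flatMap fun b =>
    dirs.flatMap fun c => [(triangle_left x z a b c).move, (triangle_right x z a b c).move]

/-! ## Strands passing over or under local extrema -/

theorem cup_pass (x : Slope) (a b : Dir) :
    WordEquivalent [a] [cup 1 b, cross x 0, cross x 1] [cup 0 b] := by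
  refine .of_rewritesTo [(0, turnCup.at 0), (1, bigons.at 1)] ?_
  cases a <;> cases b <;> cases x <;> decide +kernel

theorem cap_pass (x : Slope) (a b : Dir) :
    WordEquivalent [a, b, b.flip] [cross x 0, cross x 1, cap 0] [cap 1] := by
  refine .of_rewritesTo [(1, turnCap.symm.at 0), (0, bigons.at 0)] ?_
  cases a <;> cases b <;> cases x <;> decide +kernel

/-- A strand that crosses a local minimum twice, with crossings of slope `x`, is moved away. -/
def cupPasses (x : Slope) : MoveFamily :=
  dirs.flatMap fun a => dirs.map fun b => (cup_pass x a b).move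

/-- A strand that crosses a local maximum twice, with crossings of slope `x`, is moved away. -/
def capPasses (x : Slope) : MoveFamily :=
  dirs.flatMap fun a => dirs.map fun b => (cap_pass x a b).move

/-! ## Moves of types 4 and 5 -/

/-- A move of type 4, with crossings of slope `x`. -/
def Pass (x : Slope) (m : Marker) (a b : Dir) : Prop :=
  WordEquivalent [a, b, b.flip] [cross x 0, cross x 1, vertex m 0]
    [vertex m 1, cross x 0, cross x 1]

/-- A move of type 5, with a crossing of slope `s`. -/
def Swap (s : Slope) (m : Marker) (a : Dir) : Prop :=
  WordEquivalent [a, a.flip] [cross s 0, vertex m 0] [vertex m 0, cross s 0]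

/-- A quarter turn of the vertex: one edge is bent over, and the passing strand is also drawn across
the resulting extrema. -/
theorem Pass.turn {x : Slope} {m : Marker} {a b : Dir} (h : Pass x m a b) :
    Pass x m.turn a b.flip := by
  unfold Pass at *
  refine .of_rewritesTo
    [(3, zag.symm.at 0), (2, exchangeLeft), (1, exchangeLeft), (0, exchangeLeft),
      (3, turnCap.symm.at 1), (2, exchangeLeft), (0, (cupPasses x).symm.at 0),
      (2, h.move.at 1), (1, exchangeRight), (4, (capPasses x).at 2), (3, exchangeRight),
      (2, exchangeRight), (0, turnCup.symm.at 1), (1, exchangeRight), (0, zag.at 2)] ?_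
  cases a <;> cases b <;> cases x <;> cases m <;> rfl

/-- Bent round, the strand passes the vertex from the right; bigons with both edges convert this
into the inverse of the given move. -/
theorem Pass.reverse {x : Slope} {m : Marker} {a b : Dir} (h : Pass x m a b) :
    Pass x m a.flip b := by
  unfold Pass at *
  refine .of_rewritesTo
    [(1, zig.symm.at 1), (0, exchangeRight), (2, exchangeRight), (1, exchangeRight),
      (2, turnCap.at 0), (0, turnCup.symm.at 2), (3, exchangeRight), (4, (newBigons x).at 1),
      (5, (newBigons x).at 2), (3, h.symm.move.at 1), (2, bigons.at 1), (1, bigons.at 2),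
      (3, turnCap.symm.at 0), (2, exchangeLeft), (3, turnCap.symm.at 1), (0, exchangeLeft),
      (1, exchangeLeft), (2, exchangeLeft), (3, zig.at 2)] ?_
  cases a <;> cases b <;> cases x <;> cases m <;> rfl

/-- A crossing below a vertex, turned upside down. -/
theorem cross_vertex_rotate (s : Slope) (m : Marker) (a : Dir) :
    WordEquivalent [a, a.flip] [cross s 0, vertex m 0]
      [cup 0 a.flip, cup 1 a, vertex m 2, cross s 2, cap 3, cap 2] := by
  refine .of_rewritesTo
    [(2, zag.symm.at 0), (1, exchangeLeft), (0, exchangeLeft), (2, zag.symm.at 2),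
      (1, exchangeLeft), (0, exchangeRight), (4, turnCap.symm.at 1), (3, exchangeLeft),
      (2, exchangeLeft), (3, turnCap.symm.at 3), (4, exchangeLeft), (3, turnCap.symm.at 2),
      (0, exchangeLeft), (1, turnCup.at 1)] ?_
  cases a <;> cases s <;> cases m <;> decide +kernel

/-- A vertex below a crossing, turned upside down. -/
theorem vertex_cross_rotate (s : Slope) (m : Marker) (a : Dir) :
    WordEquivalent [a, a.flip] [cup 0 a.flip, cup 1 a, cross s 2, vertex m 2, cap 3, cap 2]
      [vertex m 0, cross s 0] := by
  refine .of_rewritesTo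
    [(3, turnCap.at 2), (4, exchangeRight), (3, turnCap.at 3), (2, exchangeRight),
      (3, turnCap.at 2), (4, exchangeRight), (3, turnCap.at 3), (1, exchangeRight),
      (2, exchangeRight), (3, exchangeRight), (3, exchangeRight), (4, exchangeRight),
      (3, zag.at 3), (0, exchangeRight), (1, exchangeRight), (2, zag.at 0)] ?_
  cases a <;> cases s <;> cases m <;> decide +kernel

theorem Swap.rotate {s : Slope} {m : Marker} {a : Dir} (h : Swap s m a) : Swap s m a.flip := by
  refine (cross_vertex_rotate s m a.flip).trans (.trans ?_ (vertex_cross_rotate s m a.flip))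
  unfold Swap at h
  refine .of_rewritesTo [(2, h.symm.move.at 2)] ?_
  cases a <;> cases s <;> cases m <;> rfl

/-- If a crossing commutes with the vertex, so does its inverse. -/
theorem Swap.invert {s : Slope} {m : Marker} {a : Dir} (h : Swap s m a) :
    Swap s.turn m a.flip := by
  unfold Swap at *
  refine .of_rewritesTo
    [(2, (newBigons s).at 0), (1, h.symm.move.at 0), (0, bigons.at 0)] ?_
  cases a <;> cases s <;> cases m <;> rfl

theorem swap_vertical (s : Slope) (a : Dir) : Swap s vertical a := by
  have h : Swap backslash vertical up :=
    Equivalent.of_move (M := Γ5) (.inr (by simp [smallMoves]))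
  cases s <;> cases a
  exacts [h.rotate.invert, h.invert, h, h.rotate]

/-- Moves of type 5 with a vertical marker. -/
def swapsVertical : MoveFamily :=
  slopes.flatMap fun s => dirs.map fun a => (swap_vertical s a).move

/-- The vertex is conjugated by a crossing of its own edges, which interchanges their directions.
Moves of type 3 carry the passing strand across both conjugating crossings. -/
theorem Pass.flip {x : Slope} {a b : Dir} (h : Pass x vertical a b.flip) :
    Pass x vertical a b := by
  unfold Pass at *
  refine .of_rewritesTo
    [(2, (newBigons slash).at 0), (3, swapsVertical.at 0), (0, triangles.at 0), (1, h.move.at 0),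
      (2, triangles.at 0), (1, swapsVertical.symm.at 1), (0, bigons.at 1)] ?_
  cases a <;> cases b <;> cases x <;> rfl

theorem pass (x : Slope) (m : Marker) (a b : Dir) : Pass x m a b := by
  have h : Pass x horizontal up up := by
    cases x
    · exact Equivalent.of_move (M := Γ4) (.inr (by simp [smallMoves]))
    · exact Equivalent.of_move (M := Γ4prime) (.inr (by simp [smallMoves]))
  have hv : Pass x vertical up down := h.turn
  have hv' (b : Dir) : Pass x vertical up b := by
    cases b
    exacts [hv.flip, hv]
  have hm (b : Dir) : Pass x m up b := by
    cases m
    · cases b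
      exacts [h, (hv' up).turn]
    · exact hv' b
  cases a
  exacts [hm b, (hm b).reverse]

/-- The moves of type 4. -/
def passes : MoveFamily :=
  slopes.flatMap fun x => markers.flatMap fun m => dirs.flatMap fun a => dirs.map fun b =>
    (pass x m a b).move

/-- A kink lets the vertex slide to a place beside an extremum, where a quarter turn makes its
marker vertical. It then passes the crossing by `swap_vertical`, is turned back, and the kink is
undone. -/
theorem swap_slash_horizontal (a : Dir) : Swap slash horizontal a := by
  unfold Swap
  refine .of_rewritesTo
    [(1, (newKinks slash).at 1), (0, exchangeRight), (3, exchangeLeft), (1, passes.at 0),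
      (3, turnCap.at 1), (0, turnCup.at 1), (1, exchangeLeft), (2, swapsVertical.symm.at 2),
      (0, turnCup.at 0), (3, turnCap.symm.at 1), (1, passes.at 1), (0, exchangeRight),
      (3, capKinks.at 2), (1, turnCup.symm.at 0), (2, exchangeRight), (1, zag.at 1)] ?_
  cases a <;> decide +kernel

theorem swap (s : Slope) (m : Marker) (a : Dir) : Swap s m a := by
  cases m
  · cases s
    · exact swap_slash_horizontal a
    · cases a
      exacts [(swap_slash_horizontal down).invert, (swap_slash_horizontal up).invert]
  · exact swap_vertical s a

/-- The moves of type 5. -/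
def swaps : MoveFamily :=
  slopes.flatMap fun s => markers.flatMap fun m => dirs.map fun a => (swap s m a).move

theorem pass_left (x : Slope) (m : Marker) (a b : Dir) :
    WordEquivalent [b, b.flip, a] [cross x 1, cross x 0, vertex m 1]
      [vertex m 0, cross x 1, cross x 0] := by
  refine .of_rewritesTo
    [(3, (newBigons x.turn).at 0), (4, (newBigons x.turn).at 1), (2, passes.symm.at 0),
      (1, bigons.at 0), (0, bigons.at 1)] ?_
  cases a <;> cases b <;> cases x <;> cases m <;> decide +kernel

/-- The moves of type 4 of a strand that comes from the right. -/
def passesLeft : MoveFamily :=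
  slopes.flatMap fun x => markers.flatMap fun m => dirs.flatMap fun a => dirs.map fun b =>
    (pass_left x m a b).move

/-! ## Moves of type 6 -/

theorem loop_up (m : Marker) : WordEquivalent [up] [cup 1 down, vertex m 0, cap 1] [] := by
  cases m
  · exact Equivalent.of_move (M := Γ6prime) (.inr (by simp [smallMoves]))
  · exact Equivalent.of_move (M := Γ6) (.inr (by simp [smallMoves]))

/-- A half turn of `loop_up`: the loop changes side and the strand is reversed. -/
theorem loop_left_down (m : Marker) :
    WordEquivalent [down] [cup 0 down, vertex m 1, cap 0] [] := by
  have h := loop_up m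
  refine .of_rewritesTo
    [(0, turnCup.symm.at 0), (0, zig.symm.at 0), (1, exchangeRight), (0, exchangeRight),
      (2, exchangeRight), (1, turnCup.symm.at 1), (3, exchangeRight), (1, h.move.at 1),
      (0, zig.at 0)] ?_
  cases m <;> rfl

theorem loop (m : Marker) (a : Dir) :
    WordEquivalent [a] [cup 1 a.flip, vertex m 0, cap 1] [] := by
  cases a
  · exact loop_up m
  · refine .trans ?_ (loop_left_down m)
    -- A bigon split by the vertex flips the loop to the left; a move of type 4 gathers the
    -- crossings into a bigon and kinks at the two extrema.
    refine .of_rewritesTo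
      [(1, (newBigons slash).at 0), (2, swaps.at 0), (0, turnCup.at 0), (3, turnCap.at 0),
        (1, (newBigons slash).at 0), (2, passes.at 0), (4, bigons.at 1), (0, cupKinks.at 0),
        (2, capKinks.at 0)] ?_
    cases m <;> decide +kernel

/-! ## Moves of type 7 -/

/-- Exchange of two vertices joined by an edge. -/
def Exchange (m n : Marker) (a : Dir) : Prop :=
  WordEquivalent [a, a.flip, a] [vertex m 0, vertex n 1] [vertex n 1, vertex m 0]

/-- Two vertices joined by an edge, turned upside down. -/
theorem left_right_rotate (m n : Marker) (a : Dir) :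
    WordEquivalent [a, a.flip, a] [vertex m 0, vertex n 1]
      [cup 0 a, cup 1 a.flip, cup 2 a, vertex n 3, vertex m 4, cap 5, cap 4, cap 3] := by
  refine .of_rewritesTo
    [(2, zag.symm.at 1), (1, exchangeLeft), (2, turnCap.symm.at 2), (1, zag.symm.at 0),
      (0, exchangeLeft), (2, exchangeLeft), (1, exchangeLeft), (2, turnCap.symm.at 3),
      (0, zag.symm.at 0), (1, exchangeLeft), (0, exchangeLeft), (3, exchangeRight),
      (2, exchangeLeft), (4, exchangeRight), (1, turnCup.at 1), (4, exchangeLeft),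
      (3, exchangeLeft), (2, exchangeLeft), (1, exchangeLeft), (5, exchangeLeft),
      (4, exchangeLeft), (3, exchangeLeft), (2, turnCup.at 2)] ?_
  cases a <;> cases m <;> cases n <;> decide +kernel

/-- Two vertices joined by an edge, turned upside down. -/
theorem right_left_rotate (m n : Marker) (a : Dir) :
    WordEquivalent [a, a.flip, a] [vertex n 1, vertex m 0]
      [cup 0 a, cup 1 a.flip, cup 2 a, vertex m 4, vertex n 3, cap 5, cap 4, cap 3] := by
  refine .of_rewritesTo
    [(2, zag.symm.at 0), (1, exchangeLeft), (0, exchangeLeft), (2, turnCap.symm.at 1),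
      (1, exchangeLeft), (2, turnCap.symm.at 2), (0, zag.symm.at 0), (1, exchangeLeft),
      (0, exchangeLeft), (2, exchangeLeft), (1, turnCup.at 1), (6, zag.symm.at 2),
      (5, exchangeLeft), (4, exchangeLeft), (6, exchangeLeft), (5, turnCap.symm.at 3),
      (3, exchangeLeft), (2, exchangeLeft), (4, exchangeLeft)] ?_
  cases a <;> cases m <;> cases n <;> decide +kernel

theorem Exchange.rotate {m n : Marker} {a : Dir} (h : Exchange m n a) :
    Exchange n m a.flip := by
  refine (left_right_rotate n m a.flip).trans (.trans ?_ (right_left_rotate n m a.flip).symm)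
  unfold Exchange at h
  refine .of_rewritesTo [(3, h.move.at 3)] ?_
  cases a <;> cases m <;> cases n <;> rfl

/-- Conjugation by a half twist of the three strands, which reverses their order and so interchanges
left and right vertex. The alternating directions are symmetric under this reversal. -/
theorem Exchange.reflect {m n : Marker} {a : Dir} (h : Exchange m n a) : Exchange n m a := by
  unfold Exchange at *
  refine .of_rewritesTo
    [(2, (newBigons slash).at 0), (3, (newBigons slash).at 1), (4, (newBigons slash).at 0),
      (1, passes.symm.at 0), (3, swaps.symm.at 0), (1, triangles.at 0), (0, passesLeft.symm.at 0),
      (2, swaps.symm.at 1), (3, h.symm.move.at 0), (0, triangles.symm.at 0), (2, swaps.at 0),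
      (0, passes.at 0), (1, triangles.at 0), (3, swaps.at 1), (1, passesLeft.at 0),
      (2, triangles.symm.at 0), (4, bigons.at 0), (3, bigons.at 1), (2, bigons.at 0)] ?_
  cases a <;> cases m <;> cases n <;> rfl

theorem exchange_up : Exchange vertical horizontal up :=
  Equivalent.of_move (M := Γ7) (.inr (by simp [smallMoves]))

theorem exchange_vertices (a : Dir) : Exchange vertical horizontal a := by
  cases a
  exacts [exchange_up, exchange_up.rotate.reflect]

/-! ## Moves of type 8 -/

/-- Two ribbons that cross each other, with four crossings of slope `x`. -/
def ribbons (x : Slope) : List Letter := [cross x 1, cross x 0, cross x 2, cross x 1]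

theorem band_pass_right (x : Slope) (m : Marker) (a b : Dir) :
    WordEquivalent [b, b.flip, a, a.flip] (ribbons x ++ [vertex m 0])
      (vertex m 2 :: ribbons x) := by
  refine .of_rewritesTo
    [(1, exchangeRight), (2, passes.at 0), (0, passes.at 1), (2, exchangeLeft)] ?_
  cases a <;> cases b <;> cases x <;> cases m <;> decide +kernel

theorem band_pass_left (x : Slope) (m : Marker) (a b : Dir) :
    WordEquivalent [b, b.flip, a, a.flip] (ribbons x ++ [vertex m 2])
      (vertex m 0 :: ribbons x) := by
  refine .of_rewritesTo [(2, passesLeft.at 1), (0, passesLeft.at 0)] ?_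
  cases a <;> cases b <;> cases x <;> cases m <;> decide +kernel

/-- A vertex slides along the right of two ribbons. -/
def bandPassRight : MoveFamily :=
  slopes.flatMap fun x => markers.flatMap fun m => dirs.flatMap fun a => dirs.map fun b =>
    (band_pass_right x m a b).move

/-- A vertex slides along the left of two ribbons. -/
def bandPassLeft : MoveFamily :=
  slopes.flatMap fun x => markers.flatMap fun m => dirs.flatMap fun a => dirs.map fun b =>
    (band_pass_left x m a b).move

/-- A move of type 8. -/
def RibbonMove (m n : Marker) (a b : Dir) : Prop :=
  WordEquivalent [b, b.flip, a, a.flip] (ribbons slash ++ [vertex m 0, vertex n 2])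
    (ribbons backslash ++ [vertex m 0, vertex n 2])

/-- One crossing of a bigon above the right vertex slides down through the vertex and along its
ribbon to the lower left. It reverses the directions entering that ribbon. -/
theorem twist_left (x : Slope) (m n : Marker) (a b : Dir) :
    WordEquivalent [b, b.flip, a, a.flip] (ribbons x ++ [vertex m 0, vertex n 2])
      (sl 0 :: ribbons x ++ [vertex m 0, vertex n 2, bs 2]) := by
  refine .of_rewritesTo
    [(4, exchangeRight), (4, (newBigons slash).at 2), (6, exchangeLeft), (5, exchangeLeft),
      (4, exchangeLeft), (6, swaps.at 2), (4, exchangeRight), (2, triangles.symm.at 1),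
      (5, exchangeRight), (0, triangles.symm.at 0), (5, exchangeLeft)] ?_
  cases a <;> cases b <;> cases x <;> cases m <;> cases n <;> decide +kernel

theorem twist_right (x : Slope) (m n : Marker) (a b : Dir) :
    WordEquivalent [b, b.flip, a, a.flip] (ribbons x ++ [vertex m 0, vertex n 2])
      (sl 2 :: ribbons x ++ [vertex m 0, vertex n 2, bs 0]) := by
  refine .of_rewritesTo
    [(4, exchangeRight), (4, (newBigons slash).at 0), (5, exchangeRight), (4, exchangeRight),
      (6, swaps.at 0), (4, exchangeLeft), (5, exchangeLeft), (6, exchangeLeft),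
      (1, exchangeRight), (6, exchangeRight), (5, exchangeRight), (2, triangles.at 0),
      (0, triangles.at 1), (2, exchangeLeft), (5, exchangeLeft)] ?_
  cases a <;> cases b <;> cases x <;> cases m <;> cases n <;> decide +kernel

theorem RibbonMove.flip_left {m n : Marker} {a b : Dir} (h : RibbonMove m n a b) :
    RibbonMove m n a b.flip := by
  refine (twist_left slash m n a b.flip).trans (.trans ?_ (twist_left backslash m n a b.flip).symm)
  unfold RibbonMove at h
  refine .of_rewritesTo [(1, h.move.at 0)] ?_
  cases a <;> cases b <;> cases m <;> cases n <;> rfl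

theorem RibbonMove.flip_right {m n : Marker} {a b : Dir} (h : RibbonMove m n a b) :
    RibbonMove m n a.flip b := by
  refine (twist_right slash m n a.flip b).trans
    (.trans ?_ (twist_right backslash m n a.flip b).symm)
  unfold RibbonMove at h
  refine .of_rewritesTo [(1, h.move.at 0)] ?_
  cases a <;> cases b <;> cases m <;> cases n <;> rfl

theorem ribbon_move (a b : Dir) : RibbonMove vertical horizontal a b := by
  have h : RibbonMove vertical horizontal up up :=
    Equivalent.of_move (M := Γ8) (.inr (by simp [smallMoves]))
  cases a <;> cases b
  exacts [h, h.flip_left, h.flip_right, h.flip_left.flip_right]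

/-- The moves of type 8, with a vertical marker on the left. -/
def ribbonMoves : MoveFamily := dirs.flatMap fun a => dirs.map fun b => (ribbon_move a b).move

/-- Slid below the ribbons, the vertices change sides, so the vertical marker is on the left. A
cancelling pair of ribbon crossings is inserted below them, `ribbon_move` changes the upper one of
the pair, and sliding the vertices down again lets the crossings above cancel. -/
theorem ribbon_move_interchanged (a b : Dir) : RibbonMove horizontal vertical a b := by
  unfold RibbonMove
  refine .of_rewritesTo
    [(0, bandPassRight.at 0), (1, bandPassLeft.at 0), (0, (newBigons backslash).at 1),
      (1, (newBigons backslash).at 0), (1, (newBigons backslash).at 2), (2, exchangeLeft),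
      (1, exchangeLeft), (3, exchangeLeft),
      (3, (newBigons backslash).at 1), (8, exchangeLeft), (4, ribbonMoves.at 0), (8, exchangeRight),
      (4, bandPassLeft.at 0), (5, bandPassRight.at 0), (9, bigons.at 1), (8, exchangeLeft),
      (7, bigons.at 0), (7, bigons.at 2), (6, bigons.at 1)] ?_
  cases a <;> cases b <;> decide +kernel

/-! ## Orientations of unoriented moves -/

/-- The letter of an unoriented layer; `d` is the direction given to a local minimum. -/
def Letter.ofLayer (d : Dir) : Layer Piece → Letter
  | ⟨i, .cup⟩ => cup i d
  | ⟨i, .cap⟩ => cap i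
  | ⟨i, .crossing s⟩ => cross s i
  | ⟨i, .vertex m⟩ => vertex m i

theorem Letter.layer_ofLayer {L : Layer OPiece} {u v : List Dir} (h : L.run u = some v) (d : Dir)
    (hd : ∀ e, L.piece = .cup e → e = d) :
    (Letter.ofLayer d ⟨L.pos, L.piece.forget⟩).layer u = L := by
  obtain ⟨l, r, hl, rfl, -⟩ := Layer.exists_of_run h
  obtain ⟨i, g⟩ := L
  obtain rfl : l.length = i := hl
  cases g with
  | cup e => rw [hd e rfl]; rfl
  | _ => simp [OPiece.forget, Letter.ofLayer, Letter.layer, OPiece.bot]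

theorem eq_orient_of_run {D : Stack} {u v : List Dir} (h : run D u = some v) (d : Dir)
    (hd : ∀ L ∈ D, ∀ e, L.piece = .cup e → e = d) :
    D = orient u ((forget D).map (Letter.ofLayer d)) := by
  induction D generalizing u with
  | nil => rfl
  | cons L D ih =>
    obtain ⟨w, hw, hD⟩ := Option.bind_eq_some_iff.mp h
    have hL := Letter.layer_ofLayer hw d (hd L (by simp))
    change L :: D = Letter.layer u _ :: orient _ _
    rw [hL, hw]
    exact congrArg _ (ih hD fun L' h' => hd L' (by simp [h']))

/-- Only the lowest layer may be a minimum, so the lower ends and a single direction `d` determine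
the whole orientation. -/
theorem exists_eq_orient {D : Stack} {E : List (Layer Piece)} {u v : List Dir}
    (h : run D u = some v) (hE : forget D = E) (hc : ∀ L ∈ E.tail, L.piece ≠ .cup) :
    ∃ d, D = orient u (E.map (Letter.ofLayer d)) := by
  subst hE
  cases D with
  | nil => exact ⟨up, rfl⟩
  | cons L D =>
    obtain ⟨d, hd⟩ : ∃ d, ∀ e, L.piece = .cup e → e = d := by
      rcases hp : L.piece with d | _ | _ | _
      · exact ⟨d, fun e he => by cases he; rfl⟩
      all_goals exact ⟨up, fun e he => by cases he⟩
    refine ⟨d, eq_orient_of_run h d ?_⟩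
    intro L' hL' e he
    rcases List.mem_cons.mp hL' with rfl | hL'
    · exact hd e he
    · exact absurd (congrArg OPiece.forget he)
        (hc ⟨L'.pos, L'.piece.forget⟩ (List.mem_map_of_mem (f := fun L : Layer OPiece =>
          (⟨L.pos, L.piece.forget⟩ : Layer Piece)) hL'))

/-- All orientations of a local move, whose local minima lie at the bottom, are consequences of the
moves of the small set. -/
def IsGenerated (U : LocalMove) : Prop :=
  (∀ L ∈ U.lhs.tail ++ U.rhs.tail, L.piece ≠ .cup) ∧
    ∀ (u : List Dir) (d e : Dir), u.length = U.width →
      (run (orient u (U.lhs.map (Letter.ofLayer d))) u).isSome →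
      WordEquivalent u (U.lhs.map (Letter.ofLayer d)) (U.rhs.map (Letter.ofLayer e))

theorem IsGenerated.equivalent {U : LocalMove} (hU : IsGenerated U) {M : OrientedMove}
    (hM : M.IsOrientationOf U) : Equivalent M.bot M.lhs.layers M.rhs.layers := by
  obtain ⟨hw, hl, hr⟩ := hM
  obtain ⟨d, hd⟩ := exists_eq_orient M.lhs.ok hl fun L h => hU.1 L (by simp [h])
  obtain ⟨e, he⟩ := exists_eq_orient M.rhs.ok hr fun L h => hU.1 L (by simp [h])
  have := hU.2 M.bot d e hw (by rw [← hd, M.lhs.ok]; rfl)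
  rw [hd, he]
  exact this

theorem isGenerated_kink (s : Slope) :
    IsGenerated ⟨1, [⟨1, .cup⟩, ⟨0, .crossing s⟩, ⟨1, .cap⟩], []⟩ := by
  refine ⟨by cases s <;> decide, fun u d e hu h => ?_⟩
  match u, hu with
  | [a], _ =>
    -- The maximum joins the through strand, directed by `a`, to the right end of the minimum,
    -- directed by `d.flip`.
    obtain rfl : d = a := by revert h; cases a <;> cases d <;> cases s <;> decide +kernel
    exact kink d s

theorem isGenerated_pass (x : Slope) (m : Marker) :
    IsGenerated ⟨3, [⟨0, .crossing x⟩, ⟨1, .crossing x⟩, ⟨0, .vertex m⟩],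
      [⟨1, .vertex m⟩, ⟨0, .crossing x⟩, ⟨1, .crossing x⟩]⟩ := by
  refine ⟨by cases x <;> cases m <;> decide, fun u d e hu h => ?_⟩
  match u, hu with
  | [a, b, c], _ =>
    obtain rfl : c = b.flip := by
      revert h; cases a <;> cases b <;> cases c <;> cases x <;> cases m <;> cases d <;>
        decide +kernel
    exact pass x m a b

theorem isGenerated_swap (s : Slope) (m : Marker) :
    IsGenerated ⟨2, [⟨0, .crossing s⟩, ⟨0, .vertex m⟩], [⟨0, .vertex m⟩, ⟨0, .crossing s⟩]⟩ := by
  refine ⟨by cases s <;> cases m <;> decide, fun u d e hu h => ?_⟩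
  match u, hu with
  | [a, b], _ =>
    obtain rfl : b = a.flip := by
      revert h; cases a <;> cases b <;> cases s <;> cases m <;> cases d <;> decide +kernel
    exact swap s m a

theorem isGenerated_loop (m : Marker) :
    IsGenerated ⟨1, [⟨1, .cup⟩, ⟨0, .vertex m⟩, ⟨1, .cap⟩], []⟩ := by
  refine ⟨by cases m <;> decide, fun u d e hu h => ?_⟩
  match u, hu with
  | [a], _ =>
    obtain rfl : d = a.flip := by revert h; cases a <;> cases d <;> cases m <;> decide +kernel
    exact loop m a

theorem isGenerated_bigon : IsGenerated Ω2 := by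
  refine ⟨by decide, fun u d e hu h => ?_⟩
  match u, hu with
  | [a, b], _ => exact bigon a b slash

theorem isGenerated_triangle : IsGenerated Ω3 := by
  refine ⟨by decide, fun u d e hu h => ?_⟩
  match u, hu with
  | [a, b, c], _ => exact triangle_left slash backslash a b c

theorem isGenerated_triangle_slash : IsGenerated Ω3a := by
  refine ⟨by decide, fun u d e hu h => ?_⟩
  match u, hu with
  | [a, b, c], _ => exact triangle_slash a b c

theorem isGenerated_exchange : IsGenerated Ω7 := by
  refine ⟨by decide, fun u d e hu h => ?_⟩
  match u, hu with
  | [a, b, c], _ =>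
    obtain ⟨rfl, rfl⟩ : b = a.flip ∧ c = a := by
      revert h; cases a <;> cases b <;> cases c <;> cases d <;> decide +kernel
    exact exchange_vertices c

theorem isGenerated_ribbon {m n : Marker} (h : ∀ a b, RibbonMove m n a b) :
    IsGenerated ⟨4, [⟨1, .crossing slash⟩, ⟨0, .crossing slash⟩, ⟨2, .crossing slash⟩,
        ⟨1, .crossing slash⟩, ⟨0, .vertex m⟩, ⟨2, .vertex n⟩],
      [⟨1, .crossing backslash⟩, ⟨0, .crossing backslash⟩, ⟨2, .crossing backslash⟩,
        ⟨1, .crossing backslash⟩, ⟨0, .vertex m⟩, ⟨2, .vertex n⟩]⟩ := by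
  refine ⟨by cases m <;> cases n <;> decide, fun u d e hu hr => ?_⟩
  match u, hu with
  | [b, b', a, a'], _ =>
    obtain ⟨rfl, rfl⟩ : b' = b.flip ∧ a' = a.flip := by
      clear h
      revert hr; cases a <;> cases b <;> cases a' <;> cases b' <;> cases d <;> cases m <;>
        cases n <;> decide +kernel
    exact h a b

/-! ### All types of moves together. -/

theorem isGenerated_of_mem {U : LocalMove} (hU : U ∈ unorientedYoshikawaMoves) :
    IsGenerated U := by
  rcases hU with rfl | rfl | rfl | rfl | rfl | rfl | rfl | rfl | rfl | rfl | rfl | rfl | rfl |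
    rfl | rfl | rfl | rfl | rfl
  exacts [isGenerated_kink slash, isGenerated_kink backslash, isGenerated_bigon,
    isGenerated_triangle, isGenerated_triangle_slash, isGenerated_pass slash horizontal,
    isGenerated_pass backslash horizontal, isGenerated_pass slash vertical,
    isGenerated_pass backslash vertical, isGenerated_swap backslash vertical,
    isGenerated_swap backslash horizontal, isGenerated_swap slash vertical,
    isGenerated_swap slash horizontal, isGenerated_loop vertical, isGenerated_loop horizontal,
    isGenerated_exchange, isGenerated_ribbon ribbon_move,
    isGenerated_ribbon ribbon_move_interchanged]

theorem smallMoves_subset : smallMoves ⊆ orientedYoshikawaMoves := by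
  have key {M : OrientedMove} (U : LocalMove) (hU : U ∈ unorientedYoshikawaMoves)
      (hM : M.IsOrientationOf U) : M ∈ orientedYoshikawaMoves := ⟨U, hU, hM⟩
  rintro M (rfl | rfl | rfl | rfl | rfl | rfl | rfl | rfl | rfl | rfl | rfl | rfl)
  exacts [key Ω1 (by simp [unorientedYoshikawaMoves]) ⟨rfl, rfl, rfl⟩,
    key Ω1a (by simp [unorientedYoshikawaMoves]) ⟨rfl, rfl, rfl⟩,
    key Ω2 (by simp [unorientedYoshikawaMoves]) ⟨rfl, rfl, rfl⟩,
    key Ω2 (by simp [unorientedYoshikawaMoves]) ⟨rfl, rfl, rfl⟩,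
    key Ω3a (by simp [unorientedYoshikawaMoves]) ⟨rfl, rfl, rfl⟩,
    key Ω4 (by simp [unorientedYoshikawaMoves]) ⟨rfl, rfl, rfl⟩,
    key Ω4prime (by simp [unorientedYoshikawaMoves]) ⟨rfl, rfl, rfl⟩,
    key Ω5 (by simp [unorientedYoshikawaMoves]) ⟨rfl, rfl, rfl⟩,
    key Ω6 (by simp [unorientedYoshikawaMoves]) ⟨rfl, rfl, rfl⟩,
    key Ω6prime (by simp [unorientedYoshikawaMoves]) ⟨rfl, rfl, rfl⟩,
    key Ω7 (by simp [unorientedYoshikawaMoves]) ⟨rfl, rfl, rfl⟩,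
    key Ω8 (by simp [unorientedYoshikawaMoves]) ⟨rfl, rfl, rfl⟩]

theorem isGeneratingSet_smallMoves : IsGeneratingSet smallMoves :=
  ⟨smallMoves_subset, fun _ _ _ _ h => h.related_of_forall_equivalent fun M hM => by
    obtain ⟨U, hU, hM⟩ := hM
    exact (isGenerated_of_mem hU).equivalent hM⟩

end MarkedGraph

theorem theorem1p4 :
    (MarkedGraph.IsGeneratingSet
      {MarkedGraph.Γ1, MarkedGraph.Γ1a, MarkedGraph.Γ2b, MarkedGraph.Γ2c, MarkedGraph.Γ3a,
        MarkedGraph.Γ4, MarkedGraph.Γ4prime, MarkedGraph.Γ5, MarkedGraph.Γ6, MarkedGraph.Γ6prime,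
        MarkedGraph.Γ7, MarkedGraph.Γ8}) ∧
    (MarkedGraph.Γ3a.IsOrientationOf MarkedGraph.Ω3a ∧
      MarkedGraph.crossingSigns MarkedGraph.Γ3a.lhs.layers = [1, 1, 1] ∧
      MarkedGraph.crossingSigns MarkedGraph.Γ3a.rhs.layers = [1, 1, 1] ∧
      MarkedGraph.HasNoncyclicTriangle MarkedGraph.Γ3a.lhs.layers ∧
      MarkedGraph.HasNoncyclicTriangle MarkedGraph.Γ3a.rhs.layers) := by
  refine ⟨MarkedGraph.isGeneratingSet_smallMoves, ⟨rfl, rfl, rfl⟩, by decide, by decide, ?_, ?_⟩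
  -- All edges of the triangle point upwards, which contradicts `b ≠ a`.
  · exact fun h => h.2 rfl
  · exact fun h => h.2 rfl
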